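/- For a finite group $G$ and a subgroup $H \le G$ let $m_G(H) = |H|\cdot|C_G(H)|$ be the Chermak--Delgado measure of $H$ in $G$, and let $|\mathrm{Im}(m_G)|$ be the number of distinct values of $m_G(H)$ as $H$ runs over all subgroups of $G$. For a positive integer $n$ put $$\mathrm{Im}_{\max}(n)=\max\{|\mathrm{Im}(m_G)| : G \text{ is a group of order } n\},$$ $$\mathrm{Im}_{\max}(n,\mathcal N)=\max\{|\mathrm{Im}(m_G)| : G \text{ is a nilpotent group of order } n\}.$$ Then: (i) $\mathrm{Im}_{\max}(60,\mathcal N)=12$ and $\mathrm{Im}_{\max}(60)=14$. (ii) The alternating group $A_5$ is non-solvable and $|\mathrm{Im}(m_{A_5})|=8$. Moreover, if $G$ is a non-solvable group of order $60$, then $G\cong A_5$ and $|\mathrm{Im}(m_G)|=8$. (iii) If $G$ is a group of order $60$, then $|\mathrm{Im}(m_G)|=\mathrm{Im}_{\max}(60)$ if and only if $G\cong D_{60}$, where $D_{60}$ is the dihedral group of order $60$. -/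

import Mathlib

universe u

namespace ChermakDelgado

/-- The Chermak-Delgado measure `|H| * |C_G(H)|` of a subgroup `H` of `G`. -/
noncomputable def measure (G : Type*) [Group G] (H : Subgroup G) : ℕ :=
  Nat.card H * Nat.card (Subgroup.centralizer (H : Set G))

/-- The number of distinct Chermak-Delgado measures of subgroups of `G`. -/
noncomputable def imCard (G : Type*) [Group G] : ℕ :=
  (Set.range (measure G)).ncard

/-- All values of `imCard G`, where `G` is a group of order `n`. -/
def imCardValues (n : ℕ) : Set ℕ :=
  {k | ∃ (G : Type u) (_ : Group G), Nat.card G = n ∧ imCard G = k}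

/-- All values of `imCard G`, where `G` is a nilpotent group of order `n`. -/
def imCardValuesNilpotent (n : ℕ) : Set ℕ :=
  {k | ∃ (G : Type u) (_ : Group G), Nat.card G = n ∧ Group.IsNilpotent G ∧ imCard G = k}

/-- The maximum of `imCard G` over all groups `G` of order `n`. -/
noncomputable def imMax (n : ℕ) : ℕ :=
  sSup (imCardValues.{u} n)

/-- The maximum of `imCard G` over all nilpotent groups `G` of order `n`. -/
noncomputable def imMaxNilpotent (n : ℕ) : ℕ :=
  sSup (imCardValuesNilpotent.{u} n)

end ChermakDelgado

/-! A group of order 60 has one or six Sylow 5-subgroups. With six, Sylow counting, Burnside's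
complement theorem and Frattini's argument fix the normalizers of the Sylow subgroups. The action on
the five cosets of a Sylow 2-normalizer is then faithful, so the group is `A₅`. There the order of a
subgroup determines its measure, and 8 values occur.

Suppose that a Sylow 5-subgroup is normal. If a Sylow 3-subgroup is not, the Sylow 5-subgroup is
central and at most 10 values survive. Otherwise take `A` and `B` normal of orders 3 and 5, and the
abelian normal Hall subgroup `N = AB` of order 15. Since Sylow 2-subgroups are abelian, `C(H)N = C(H
∩ N)`, which gives `225 m(H) = m(H ∩ N) · |HN| |C_N(HN)|` (`card_sq_mul_measure`). The first factor
takes at most four values, and the second depends only on an overgroup of `N`.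

An element of order 4 leaves at most three overgroups, hence at most 12 values. Without one, `C(A)`
and `C(B)` have order 30 or 60, and counting products gives at most 13 unless `C(A) = C(B)` has
order 30. In that case an involution inverts a cyclic subgroup of order 30, so the group is
dihedral, and all pairs of factors occur: sixteen products, fourteen values.

Nilpotent groups of order 60 are abelian, so the measure is `60|H|`, with one possible value per
divisor of 60; the cyclic group attains all 12. -/

namespace ChermakDelgado

open Subgroup

/-! ### Order formulas, complements and Sylow arguments -/

section Toolbox

variable {G : Type*} [Group G]

theorem card_sup_mul_card_inf (H N : Subgroup G) [N.Normal] :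
    Nat.card (H ⊔ N : Subgroup G) * Nat.card (H ⊓ N : Subgroup G) = Nat.card H * Nat.card N := by
  have h1 := card_mul_index (N.subgroupOf (H ⊔ N))
  have h2 := card_mul_index (N.subgroupOf H)
  rw [Nat.card_congr (subgroupOfEquivOfLe le_sup_right).toEquiv] at h1
  rw [← inf_subgroupOf_left, Nat.card_congr (subgroupOfEquivOfLe inf_le_left).toEquiv,
    inf_subgroupOf_left] at h2
  change _ * N.relIndex _ = _ at h1
  change _ * N.relIndex _ = _ at h2
  rw [relIndex_sup_right] at h1
  rw [← h1, ← h2]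
  ring

theorem eq_of_le_of_card_eq [Finite G] {H K : Subgroup G} (h : H ≤ K)
    (hc : Nat.card H = Nat.card K) : H = K :=
  Subgroup.eq_of_le_of_card_ge h hc.ge

theorem card_sup_of_coprime [Finite G] (H N : Subgroup G) [N.Normal]
    (h : (Nat.card H).Coprime (Nat.card N)) :
    Nat.card (H ⊔ N : Subgroup G) = Nat.card H * Nat.card N := by
  have := card_sup_mul_card_inf H N
  rwa [disjoint_iff.mp (disjoint_of_coprime_natCard h), card_bot, mul_one] at this

theorem isMulCommutative_of_card_sq {p : ℕ} [Fact p.Prime] {H : Subgroup G}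
    (h : Nat.card H = p ^ 2) :
    IsMulCommutative H := IsPGroup.isMulCommutative_of_card_eq_prime_sq h

theorem isMulCommutative_of_card_prime {p : ℕ} [Fact p.Prime] {H : Subgroup G}
    (h : Nat.card H = p) :
    IsMulCommutative H :=
  have := isCyclic_of_prime_card h
  inferInstance

/-- Schur–Zassenhaus inside `H`: the trace of a normal Hall subgroup on `H` is again a normal Hall
subgroup. -/
theorem exists_complement_inf (N : Subgroup G) [N.Normal]
    (hN : (Nat.card N).Coprime N.index) (H : Subgroup G) :
    ∃ Q : Subgroup G, Q ≤ H ∧ H ⊓ N ⊔ Q = H ∧ Nat.card Q = N.relIndex H := by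
  have hcop : (Nat.card (N.subgroupOf H)).Coprime (N.subgroupOf H).index := by
    refine Nat.Coprime.coprime_dvd_left ?_ (hN.coprime_dvd_right
      (relIndex_dvd_index_of_normal N H))
    rw [← inf_subgroupOf_left, Nat.card_congr (subgroupOfEquivOfLe inf_le_left).toEquiv]
    exact card_dvd_of_le inf_le_right
  obtain ⟨K, hK⟩ := exists_right_complement'_of_coprime hcop
  refine ⟨K.map H.subtype, map_subtype_le K, ?_, ?_⟩
  · have := congrArg (Subgroup.map H.subtype) hK.sup_eq_top
    rwa [Subgroup.map_sup, subgroupOf_map_subtype, ← MonoidHom.range_eq_map, range_subtype,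
      inf_comm] at this
  · rw [Nat.card_congr (K.equivMapOfInjective _ H.subtype_injective).symm.toEquiv]
    exact hK.symm.index_eq_card.symm

variable [Finite G] {p : ℕ} [Fact p.Prime]

theorem exists_sylow_le {q : ℕ} (hq : q = p ^ (Nat.card G).factorization p) (H : Subgroup G)
    (hH : q ∣ Nat.card H) : ∃ Q : Sylow p G, (Q : Subgroup G) ≤ H ∧ Nat.card Q = q := by
  subst hq
  obtain ⟨K, hK⟩ := Sylow.exists_subgroup_card_pow_prime p hH
  have hc : Nat.card (K.map H.subtype) = p ^ (Nat.card G).factorization p := by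
    rw [← hK]
    exact Nat.card_congr (K.equivMapOfInjective _ H.subtype_injective).symm.toEquiv
  exact ⟨Sylow.ofCard _ hc, map_subtype_le K, hc⟩

theorem exists_mem_orderOf (H : Subgroup G) (h : p ∣ Nat.card H) : ∃ x ∈ H, orderOf x = p := by
  obtain ⟨x, hx⟩ := exists_prime_orderOf_dvd_card' (G := H) p h
  exact ⟨x, x.2, by rw [← hx, orderOf_coe]⟩

theorem card_sylow_mul_card_normalizer (P : Sylow p G) :
    Nat.card (Sylow p G) * Nat.card (normalizer (P : Set G)) = Nat.card G := by
  rw [P.card_eq_index_normalizer, index_mul_card]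

/-- Frattini's argument, in terms of orders. -/
theorem card_mul_card_normalizer (L : Subgroup G) [L.Normal] (P : Sylow p G)
    (hP : (P : Subgroup G) ≤ L) :
    Nat.card (normalizer (P : Set G)) * Nat.card L =
      Nat.card G * Nat.card (normalizer (P : Set G) ⊓ L : Subgroup G) := by
  rw [← card_sup_mul_card_inf, P.normalizer_sup_eq_top' hP, card_top]

/-- Burnside's normal complement theorem, in terms of orders. -/
theorem exists_normal_card_mul (P : Sylow p G)
    (hP : normalizer (P : Set G) ≤ centralizer (P : Set G)) :
    ∃ K : Subgroup G, K.Normal ∧ Nat.card K * Nat.card P = Nat.card G :=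
  ⟨_, inferInstance, (MonoidHom.ker_transferSylow_isComplement' P hP).card_mul_card⟩

/-- `P` is also a Sylow subgroup of `H`. The number of its conjugates there divides `|H| / |P|` and
is 1 mod `p`; the hypothesis on `d` says that arithmetic leaves only 1. -/
theorem le_normalizer_of_card (P : Sylow p G) (H : Subgroup G) (hP : (P : Subgroup G) ≤ H)
    (h : ∀ d, d * Nat.card P ∣ Nat.card H → d % p = 1 → d = 1) :
    H ≤ normalizer (P : Set G) := by
  have hd := (P.subtype hP).card_dvd_index
  have hm : Nat.card (Sylow p H) ≡ 1 [MOD p] := card_sylow_modEq_one p H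
  have h1 : Nat.card (Sylow p H) = 1 := by
    apply h
    · rw [← index_mul_card (P.subtype hP : Subgroup H)]
      refine mul_dvd_mul hd (dvd_of_eq ?_)
      exact (Nat.card_congr (subgroupOfEquivOfLe hP).toEquiv).symm
    · rw [hm, Nat.mod_eq_of_lt (Fact.out : p.Prime).one_lt]
  have : Subsingleton (Sylow p H) := (Nat.card_eq_one_iff_unique.mp h1).1
  have hn := (P.subtype hP).normal_of_subsingleton
  rw [Sylow.coe_subtype, normal_subgroupOf_iff_le_normalizer hP] at hn
  exact hn

end Toolbox

/-! ### Isomorphism invariance and counting of values -/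

section Basic

variable {G G' : Type*} [Group G] [Group G']

theorem measure_map (e : G ≃* G') (H : Subgroup G) :
    measure G' (H.map e.toMonoidHom) = measure G H := by
  have h : centralizer (H.map e.toMonoidHom : Set G') =
      (centralizer (H : Set G)).map e.toMonoidHom := by
    ext x
    obtain ⟨x, rfl⟩ := e.surjective x
    simp [mem_centralizer_iff, Subgroup.mem_map, ← map_mul]
  rw [measure, measure, h,
    Nat.card_congr (H.equivMapOfInjective _ e.injective).symm.toEquiv,
    Nat.card_congr ((centralizer (H : Set G)).equivMapOfInjective _ e.injective).symm.toEquiv]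

theorem imCard_congr (e : G ≃* G') : imCard G = imCard G' := by
  unfold imCard
  congr 1
  apply subset_antisymm
  · rintro _ ⟨H, rfl⟩
    exact ⟨_, measure_map e H⟩
  · rintro _ ⟨H, rfl⟩
    exact ⟨_, measure_map e.symm H⟩

theorem imCard_le (s : Finset ℕ) (h : ∀ H : Subgroup G, measure G H ∈ s) :
    imCard G ≤ s.card := by
  rw [imCard, ← Set.ncard_coe_finset]
  exact Set.ncard_le_ncard (by rintro _ ⟨H, rfl⟩; exact h H) s.finite_toSet

theorem imCard_eq (s : Finset ℕ) (h : ∀ H : Subgroup G, measure G H ∈ s)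
    (h' : ∀ m ∈ s, ∃ H : Subgroup G, measure G H = m) : imCard G = s.card := by
  rw [imCard, ← Set.ncard_coe_finset]
  congr 1
  exact subset_antisymm (by rintro _ ⟨H, rfl⟩; exact h H) h'

end Basic

instance : Fact (Nat.Prime 5) := ⟨Nat.prime_five⟩

/-! ### Subgroup orders and Sylow subgroups in order 60 -/

section Sixty

variable {G : Type*} [Group G]

theorem dvd_card_of_le {n : ℕ} {K H : Subgroup G} (hK : Nat.card K = n) (h : K ≤ H) :
    n ∣ Nat.card H := by
  subst hK
  exact card_dvd_of_le h

theorem isMulCommutative_of_card_four {H : Subgroup G} (h : Nat.card H = 4) :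
    IsMulCommutative H := isMulCommutative_of_card_sq (p := 2) h

theorem card_subgroup_dvd_sixty (h60 : Nat.card G = 60) (H : Subgroup G) : Nat.card H ∣ 60 :=
  h60 ▸ card_subgroup_dvd_card H

theorem factorization_sixty :
    Nat.factorization 60 2 = 2 ∧ Nat.factorization 60 3 = 1 ∧ Nat.factorization 60 5 = 1 := by
  have h2 : Nat.factorization 60 = Nat.factorization (2 ^ 2 * 3 ^ 1 * 5 ^ 1) := by norm_num
  rw [h2, Nat.factorization_mul (by norm_num) (by norm_num),
    Nat.factorization_mul (by norm_num) (by norm_num), Nat.prime_two.factorization_pow,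
    Nat.prime_three.factorization_pow, Nat.prime_five.factorization_pow]
  simp

theorem card_subgroup_mem (h60 : Nat.card G = 60) (H : Subgroup G) :
    Nat.card H ∈ ({1, 2, 3, 4, 5, 6, 10, 12, 15, 20, 30, 60} : Finset ℕ) := by
  have h : Nat.card H ∈ Nat.divisors 60 :=
    Nat.mem_divisors.mpr ⟨card_subgroup_dvd_sixty h60 H, by norm_num⟩
  have e : Nat.divisors 60 = {1, 2, 3, 4, 5, 6, 10, 12, 15, 20, 30, 60} := by decide
  rwa [e] at h

variable [Finite G] (h60 : Nat.card G = 60)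
include h60

theorem card_sylow_two (P : Sylow 2 G) : Nat.card P = 4 := by
  rw [P.card_eq_multiplicity, h60, factorization_sixty.1]; rfl

theorem card_sylow_three (P : Sylow 3 G) : Nat.card P = 3 := by
  rw [P.card_eq_multiplicity, h60, factorization_sixty.2.1]; rfl

theorem card_sylow_five (P : Sylow 5 G) : Nat.card P = 5 := by
  rw [P.card_eq_multiplicity, h60, factorization_sixty.2.2]; rfl

theorem exists_sylow_three_le (H : Subgroup G) (h : 3 ∣ Nat.card H) :
    ∃ P : Sylow 3 G, (P : Subgroup G) ≤ H := by
  obtain ⟨P, hP, -⟩ := exists_sylow_le (p := 3) (q := 3)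
    (by rw [h60, factorization_sixty.2.1]; rfl) H h
  exact ⟨P, hP⟩

theorem exists_sylow_five_le (H : Subgroup G) (h : 5 ∣ Nat.card H) :
    ∃ P : Sylow 5 G, (P : Subgroup G) ≤ H := by
  obtain ⟨P, hP, -⟩ := exists_sylow_le (p := 5) (q := 5)
    (by rw [h60, factorization_sixty.2.2]; rfl) H h
  exact ⟨P, hP⟩

theorem card_sylow_five_eq : Nat.card (Sylow 5 G) = 1 ∨ Nat.card (Sylow 5 G) = 6 := by
  have hm : Nat.card (Sylow 5 G) % 5 = 1 := card_sylow_modEq_one 5 G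
  obtain ⟨Q⟩ : Nonempty (Sylow 5 G) := inferInstance
  have h1 := card_sylow_mul_card_normalizer Q
  rw [h60] at h1
  have h2 : 5 ∣ Nat.card (normalizer (Q : Set G)) :=
    dvd_card_of_le (card_sylow_five h60 Q) le_normalizer
  obtain ⟨k, hk⟩ := h2
  have h3 : Nat.card (Sylow 5 G) ∣ 12 := ⟨k, by rw [hk] at h1; nlinarith⟩
  have h4 := Nat.le_of_dvd (by norm_num) h3
  interval_cases h : Nat.card (Sylow 5 G) <;> omega

end Sixty

/-! ### Six Sylow 5-subgroups: normalizers, and the isomorphism with `A₅` -/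

section SixSylowFive

variable {G : Type*} [Group G] [Finite G] (h60 : Nat.card G = 60) (h6 : Nat.card (Sylow 5 G) = 6)
include h60 h6

theorem card_normalizer_five (Q : Sylow 5 G) : Nat.card (normalizer (Q : Set G)) = 10 := by
  have := card_sylow_mul_card_normalizer Q
  rw [h60, h6] at this
  omega

/-- Such a subgroup would have a normal Sylow 5-subgroup, but the normalizer of the latter has order
only 10. -/
theorem not_card_fifteen_twenty (H : Subgroup G) : Nat.card H ≠ 15 ∧ Nat.card H ≠ 20 := by
  rw [← not_or]
  intro h
  obtain ⟨Q, hQ⟩ := exists_sylow_five_le h60 H (by omega)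
  have hle : H ≤ normalizer (Q : Set G) := by
    apply le_normalizer_of_card Q H hQ
    rw [card_sylow_five h60]
    intro d hd h5
    obtain h | h := h <;> rw [h] at hd <;> have := Nat.le_of_dvd (by norm_num) hd <;> omega
  have := card_le_of_le hle
  rw [card_normalizer_five h60 h6] at this
  omega

/-- The index is 1 mod 3, leaving orders 6, 15 and 60. Order 15 is excluded already, and a normal
`R` would yield `QR` of order 15. -/
theorem card_normalizer_three (R : Sylow 3 G) : Nat.card (normalizer (R : Set G)) = 6 := by
  have h := card_sylow_mul_card_normalizer R
  have hm : Nat.card (Sylow 3 G) % 3 = 1 := card_sylow_modEq_one 3 G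
  rw [h60] at h
  have h15 := (not_card_fifteen_twenty h60 h6 (normalizer (R : Set G))).1
  have hR := card_sylow_three h60 R
  have h2 : 3 ∣ Nat.card (normalizer (R : Set G)) := dvd_card_of_le hR le_normalizer
  have h60' : Nat.card (normalizer (R : Set G)) ≠ 60 := by
    intro h'
    have hn : (R : Subgroup G).Normal := by
      rw [← normalizer_eq_top_iff]
      exact eq_top_of_card_eq _ (h'.trans h60.symm)
    obtain ⟨Q⟩ : Nonempty (Sylow 5 G) := inferInstance
    have := card_sup_of_coprime (Q : Subgroup G) (R : Subgroup G)
    rw [card_sylow_five h60 Q, hR] at this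
    exact (not_card_fifteen_twenty h60 h6 _).1 (this (by norm_num))
  have := card_subgroup_mem h60 (normalizer (R : Set G))
  simp only [Finset.mem_insert, Finset.mem_singleton] at this
  obtain h' | h' | h' | h' | h' | h' | h' | h' | h' | h' | h' | h' := this <;>
    rw [h'] at h h15 h60' h2 ⊢ <;> omega

theorem card_centralizer_three (R : Sylow 3 G) : Nat.card (centralizer (R : Set G)) = 3 := by
  have hN := card_normalizer_three h60 h6 R
  have hle : centralizer (R : Set G) ≤ normalizer (R : Set G) := centralizer_le_normalizer _
  have hR := card_sylow_three h60 R
  have hc : IsMulCommutative (R : Subgroup G) := isMulCommutative_of_card_prime (p := 3) hR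
  have h3 : 3 ∣ Nat.card (centralizer (R : Set G)) := dvd_card_of_le hR R.le_centralizer
  have h6' := card_dvd_of_le hle
  rw [hN] at h6'
  have hne : Nat.card (centralizer (R : Set G)) ≠ 6 := by
    intro h
    -- Burnside's theorem would give a complement of order 20.
    obtain ⟨K, -, hK⟩ := exists_normal_card_mul R (eq_of_le_of_card_eq hle (h.trans hN.symm)).ge
    rw [hR, h60] at hK
    exact (not_card_fifteen_twenty h60 h6 K).2 (by omega)
  have := Nat.le_of_dvd (by norm_num) h6'
  interval_cases Nat.card (centralizer (R : Set G)) <;> omega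

/-- Frattini gives `6|K| = 60 |N(R) ∩ K|`, and 3 divides the last factor, so `|K|` is at least 30.
-/
theorem not_three_dvd_card_normal (K : Subgroup G) [K.Normal] (hK : Nat.card K < 30) :
    ¬ 3 ∣ Nat.card K := by
  intro h
  obtain ⟨R, hR⟩ := exists_sylow_three_le h60 K h
  have h1 := card_mul_card_normalizer K R hR
  rw [card_normalizer_three h60 h6, h60] at h1
  have h3 : 3 ∣ Nat.card (normalizer (R : Set G) ⊓ K : Subgroup G) :=
    dvd_card_of_le (card_sylow_three h60 R) (le_inf le_normalizer hR)
  have : 0 < Nat.card K := Nat.card_pos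
  omega

theorem card_centralizer_five (Q : Sylow 5 G) : Nat.card (centralizer (Q : Set G)) = 5 := by
  have hN := card_normalizer_five h60 h6 Q
  have hle : centralizer (Q : Set G) ≤ normalizer (Q : Set G) := centralizer_le_normalizer _
  have hQ := card_sylow_five h60 Q
  have hc : IsMulCommutative (Q : Subgroup G) := isMulCommutative_of_card_prime (p := 5) hQ
  have h5 : 5 ∣ Nat.card (centralizer (Q : Set G)) := dvd_card_of_le hQ Q.le_centralizer
  have h10 := card_dvd_of_le hle
  rw [hN] at h10
  have hne : Nat.card (centralizer (Q : Set G)) ≠ 10 := by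
    intro h
    obtain ⟨K, hn, hK⟩ := exists_normal_card_mul Q (eq_of_le_of_card_eq hle (h.trans hN.symm)).ge
    rw [hQ, h60] at hK
    exact not_three_dvd_card_normal h60 h6 K (by omega) (by omega)
  have := Nat.le_of_dvd (by norm_num) h10
  interval_cases Nat.card (centralizer (Q : Set G)) <;> omega

/-- The order is a multiple of 4. Order 4 yields a normal complement of order 15 by Burnside, and
order 60 yields `QP` of order 20; both are excluded, as is 20 itself. -/
theorem card_normalizer_two (P : Sylow 2 G) : Nat.card (normalizer (P : Set G)) = 12 := by
  have hP := card_sylow_two h60 P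
  have hc : IsMulCommutative (P : Subgroup G) := isMulCommutative_of_card_sq (p := 2) hP
  have h4 : 4 ∣ Nat.card (normalizer (P : Set G)) := dvd_card_of_le hP le_normalizer
  have hne4 : Nat.card (normalizer (P : Set G)) ≠ 4 := by
    intro h
    have he : (P : Subgroup G) = normalizer (P : Set G) :=
      eq_of_le_of_card_eq le_normalizer (hP.trans h.symm)
    obtain ⟨K, hn, hK⟩ := exists_normal_card_mul P (he.symm.le.trans P.le_centralizer)
    rw [hP, h60] at hK
    exact (not_card_fifteen_twenty h60 h6 K).1 (by omega)
  have hne20 := (not_card_fifteen_twenty h60 h6 (normalizer (P : Set G))).2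
  have hne60 : Nat.card (normalizer (P : Set G)) ≠ 60 := by
    intro h'
    have hn : (P : Subgroup G).Normal := by
      rw [← normalizer_eq_top_iff]
      exact eq_top_of_card_eq _ (h'.trans h60.symm)
    obtain ⟨Q⟩ : Nonempty (Sylow 5 G) := inferInstance
    have := card_sup_of_coprime (Q : Subgroup G) (P : Subgroup G)
    rw [card_sylow_five h60 Q, hP] at this
    exact (not_card_fifteen_twenty h60 h6 _).2 (this (by norm_num))
  have := card_subgroup_mem h60 (normalizer (P : Set G))
  simp only [Finset.mem_insert, Finset.mem_singleton] at this
  omega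

/-- `Q` is normal in `QK`, so `[Q, K] ≤ Q ∩ K = 1`. Thus `K` lies in `C(Q)`, whose order 5 is
coprime to `|K|`. -/
theorem eq_bot_of_normal_of_card_dvd_four (K : Subgroup G) [K.Normal] (hK : Nat.card K ∣ 4) :
    K = ⊥ := by
  obtain ⟨Q⟩ : Nonempty (Sylow 5 G) := inferInstance
  have hQ := card_sylow_five h60 Q
  have hle : Nat.card K ≤ 4 := Nat.le_of_dvd (by norm_num) hK
  have hs := card_sup_of_coprime (Q : Subgroup G) K
  rw [hQ] at hs
  replace hs := hs ((show Nat.Coprime 5 4 by norm_num).coprime_dvd_right hK)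
  have hQn : K ≤ normalizer (Q : Set G) := by
    refine le_trans ?_ (le_normalizer_of_card Q ((Q : Subgroup G) ⊔ K) le_sup_left ?_)
    · exact le_sup_right
    · rw [hs, hQ]
      intro d hd h5
      have := Nat.le_of_dvd (Nat.mul_pos (by norm_num) Nat.card_pos) hd
      omega
  have hQK : K ≤ centralizer (Q : Set G) := by
    intro k hk x hx
    have h1 : x * k * x⁻¹ * k⁻¹ ∈ (Q : Subgroup G) ⊓ K := by
      refine mem_inf.mpr ⟨?_, ?_⟩
      · have := (mem_normalizer_iff.mp (hQn hk) x⁻¹).mp (inv_mem (S := Subgroup G) hx)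
        have := mul_mem (show x ∈ (Q : Subgroup G) from hx) this
        rw [← mul_assoc, ← mul_assoc] at this
        exact this
      · exact mul_mem (Normal.conj_mem inferInstance k hk x) (inv_mem hk)
    have h2 : (Q : Subgroup G) ⊓ K = ⊥ := disjoint_iff.mp (disjoint_of_coprime_natCard
      (by rw [hQ]; exact (show Nat.Coprime 5 4 by norm_num).coprime_dvd_right hK))
    rw [h2, mem_bot, mul_inv_eq_one, mul_inv_eq_iff_eq_mul] at h1
    exact h1
  have := card_dvd_of_le hQK
  rw [card_centralizer_five h60 h6] at this
  have h1 := Nat.eq_one_of_dvd_coprimes (show Nat.Coprime 5 4 by norm_num) this hK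
  exact card_eq_one.mp h1

/-- The group acts on the five cosets of a Sylow 2-normalizer. The kernel has order dividing 12 and
prime to 3, hence is trivial; the image has index 2 in `S₅`. -/
theorem nonempty_mulEquiv_alternatingGroup : Nonempty (G ≃* alternatingGroup (Fin 5)) := by
  obtain ⟨P⟩ : Nonempty (Sylow 2 G) := inferInstance
  set M := normalizer (P : Set G) with hM
  have hM12 : Nat.card M = 12 := card_normalizer_two h60 h6 P
  have hi : Nat.card (G ⧸ M) = 5 := by
    have := index_mul_card M
    rw [hM12, h60] at this
    change M.index = 5
    omega
  have hcore : M.normalCore = ⊥ := by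
    have h12 : Nat.card M.normalCore ∣ 12 := hM12 ▸ card_dvd_of_le M.normalCore_le
    have hle := Nat.le_of_dvd (by norm_num) h12
    have h3 := not_three_dvd_card_normal h60 h6 M.normalCore (by omega)
    exact eq_bot_of_normal_of_card_dvd_four h60 h6 _
      (((Nat.prime_three.coprime_iff_not_dvd.mpr h3).symm).dvd_of_dvd_mul_left h12)
  let e : G ⧸ M ≃ Fin 5 := Finite.equivFinOfCardEq hi
  let f : G →* Equiv.Perm (Fin 5) :=
    (e.permCongrHom.toMonoidHom).comp (MulAction.toPermHom G (G ⧸ M))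
  have hf : Function.Injective f := by
    refine e.permCongrHom.injective.comp ?_
    rw [← MonoidHom.ker_eq_bot_iff, ← normalCore_eq_ker, hcore]
  have hr : f.range = alternatingGroup (Fin 5) := by
    apply Equiv.Perm.eq_alternatingGroup_of_index_eq_two
    have h1 := index_mul_card f.range
    rw [Nat.card_congr (MonoidHom.ofInjective hf).symm.toEquiv, h60, Nat.card_perm,
      Nat.card_fin] at h1
    norm_num [Nat.factorial] at h1
    omega
  exact ⟨(MonoidHom.ofInjective hf).trans (MulEquiv.subgroupCongr hr)⟩

end SixSylowFive

theorem dvd_four {n : ℕ} (h : n ∣ 4) : n = 1 ∨ n = 2 ∨ n = 4 := by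
  have := Nat.le_of_dvd (by norm_num) h
  interval_cases n <;> omega

/-! ### Six Sylow 5-subgroups: the eight measures -/

section SixSylowFive

variable {G : Type*} [Group G] [Finite G] (h60 : Nat.card G = 60)
include h60

theorem four_dvd_card_centralizer_of_isPGroup (H : Subgroup G) (hH : IsPGroup 2 H) :
    4 ∣ Nat.card (centralizer (H : Set G)) := by
  obtain ⟨P, hP⟩ := hH.exists_le_sylow
  have hc : IsMulCommutative (P : Subgroup G) :=
    isMulCommutative_of_card_four (card_sylow_two h60 P)
  exact dvd_card_of_le (card_sylow_two h60 P) (P.le_centralizer.trans (centralizer_le hP))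

variable (h6 : Nat.card (Sylow 5 G) = 6)
include h6

theorem card_centralizer_dvd_of_five_dvd (H : Subgroup G) (h : 5 ∣ Nat.card H) :
    Nat.card (centralizer (H : Set G)) ∣ 5 := by
  obtain ⟨Q, hQ⟩ := exists_sylow_five_le h60 H h
  rw [← card_centralizer_five h60 h6 Q]
  exact card_dvd_of_le (centralizer_le hQ)

theorem card_centralizer_dvd_of_three_dvd (H : Subgroup G) (h : 3 ∣ Nat.card H) :
    Nat.card (centralizer (H : Set G)) ∣ 3 := by
  obtain ⟨R, hR⟩ := exists_sylow_three_le h60 H h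
  rw [← card_centralizer_three h60 h6 R]
  exact card_dvd_of_le (centralizer_le hR)

/-- By duality `H ≤ C(C(H))`: if 3 or 5 divided `|C(H)|`, the double centralizer would have odd
order, yet it contains `H`. -/
theorem card_centralizer_dvd_of_two_dvd (H : Subgroup G) (h : 2 ∣ Nat.card H) :
    Nat.card (centralizer (H : Set G)) ∣ 4 := by
  have h3 : ¬ 3 ∣ Nat.card (centralizer (H : Set G)) := fun h3 => by
    have h1 := h.trans (card_dvd_of_le (le_centralizer_iff.mp le_rfl))
    have := h1.trans (card_centralizer_dvd_of_three_dvd h60 h6 _ h3)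
    omega
  have h5 : ¬ 5 ∣ Nat.card (centralizer (H : Set G)) := fun h5 => by
    have h1 := h.trans (card_dvd_of_le (le_centralizer_iff.mp le_rfl))
    have := h1.trans (card_centralizer_dvd_of_five_dvd h60 h6 _ h5)
    omega
  have := card_subgroup_mem h60 (centralizer (H : Set G))
  simp only [Finset.mem_insert, Finset.mem_singleton] at this
  obtain h | h | h | h | h | h | h | h | h | h | h | h := this <;> rw [h] at h3 h5 ⊢ <;> omega

theorem imCard_of_card_sylow_five (h30 : ∀ H : Subgroup G, Nat.card H ≠ 30) : imCard G = 8 := by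
  -- The order of `H` determines its measure; orders 1 and 60 share the value 60, so nine orders
  -- give eight values.
  have key (H : Subgroup G) : (Nat.card H, measure G H) ∈
      ({(1, 60), (2, 8), (3, 9), (4, 16), (5, 25), (6, 6), (10, 10), (12, 12), (60, 60)} :
        Finset (ℕ × ℕ)) := by
    have hH := card_subgroup_mem h60 H
    have h5 (h : 5 ∣ Nat.card H) := (Nat.dvd_prime Nat.prime_five).mp
      (card_centralizer_dvd_of_five_dvd h60 h6 H h)
    have h3 (h : 3 ∣ Nat.card H) := (Nat.dvd_prime Nat.prime_three).mp
      (card_centralizer_dvd_of_three_dvd h60 h6 H h)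
    have h2 (h : 2 ∣ Nat.card H) := dvd_four
      (card_centralizer_dvd_of_two_dvd h60 h6 H h)
    have h15 := not_card_fifteen_twenty h60 h6 H
    have h30 := h30 H
    have hp := four_dvd_card_centralizer_of_isPGroup h60 H
    have hp1 (h : Nat.card H = 2) := hp (IsPGroup.of_card (n := 1) h)
    have hp2 (h : Nat.card H = 4) := hp (IsPGroup.of_card (n := 2) h)
    have hc (_ : IsMulCommutative H) : Nat.card H ∣ Nat.card (centralizer (H : Set G)) :=
      card_dvd_of_le H.le_centralizer
    have hc3 (h : Nat.card H = 3) := h ▸ hc (isMulCommutative_of_card_prime (p := 3) h)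
    have hc5 (h : Nat.card H = 5) := h ▸ hc (isMulCommutative_of_card_prime (p := 5) h)
    have h1 (h : Nat.card H = 1) : Nat.card (centralizer (H : Set G)) = 60 := by
      rw [card_eq_one.mp h, ← h60, card_eq_iff_eq_top, centralizer_eq_top_iff_subset]
      simp
    simp only [Finset.mem_insert, Finset.mem_singleton] at hH
    simp only [measure, Finset.mem_insert, Finset.mem_singleton, Prod.mk.injEq]
    clear hp hc
    generalize Nat.card (centralizer (H : Set G)) = c at *
    generalize Nat.card H = n at *
    obtain h | h | h | h | h | h | h | h | h | h | h | h := hH <;> subst h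
    · simp [h1 rfl]
    · simp [show c = 4 by omega]
    · simp [show c = 3 by omega]
    · simp [show c = 4 by omega]
    · simp [show c = 5 by omega]
    · simp [show c = 1 by omega]
    · simp [show c = 1 by omega]
    · simp [show c = 1 by omega]
    · exact absurd rfl h15.1
    · exact absurd rfl h15.2
    · exact absurd rfl h30
    · simp [show c = 1 by omega]
  have hex (n m : ℕ) (hn : ∃ H : Subgroup G, Nat.card H = n)
      (hm : ∀ k, (n, k) ∈ ({(1, 60), (2, 8), (3, 9), (4, 16), (5, 25), (6, 6), (10, 10), (12, 12),
        (60, 60)} : Finset (ℕ × ℕ)) → k = m) : ∃ H : Subgroup G, measure G H = m := by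
    obtain ⟨H, rfl⟩ := hn
    exact ⟨H, hm _ (key H)⟩
  obtain ⟨P⟩ : Nonempty (Sylow 2 G) := inferInstance
  obtain ⟨R⟩ : Nonempty (Sylow 3 G) := inferInstance
  obtain ⟨Q⟩ : Nonempty (Sylow 5 G) := inferInstance
  refine imCard_eq {60, 8, 9, 16, 25, 6, 10, 12} (fun H => ?_) (fun m hm => ?_)
  · have := key H
    simp only [Finset.mem_insert, Finset.mem_singleton, Prod.mk.injEq] at this ⊢
    omega
  · simp only [Finset.mem_insert, Finset.mem_singleton] at hm
    obtain rfl | rfl | rfl | rfl | rfl | rfl | rfl | rfl := hm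
    · exact hex 1 _ ⟨⊥, card_bot⟩ (by simp)
    · exact hex 2 _ (Sylow.exists_subgroup_card_pow_prime 2 (n := 1) (by rw [h60]; norm_num))
        (by simp)
    · exact hex 3 _ ⟨R, card_sylow_three h60 R⟩ (by simp)
    · exact hex 4 _ ⟨P, card_sylow_two h60 P⟩ (by simp)
    · exact hex 5 _ ⟨Q, card_sylow_five h60 Q⟩ (by simp)
    · exact hex 6 _ ⟨_, card_normalizer_three h60 h6 R⟩ (by simp)
    · exact hex 10 _ ⟨_, card_normalizer_five h60 h6 Q⟩ (by simp)
    · exact hex 12 _ ⟨_, card_normalizer_two h60 h6 P⟩ (by simp)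

end SixSylowFive

/-! ### Non-solvability and `A₅` -/

section AlternatingGroup

theorem card_alternatingGroup_five : Nat.card (alternatingGroup (Fin 5)) = 60 := by
  rw [nat_card_alternatingGroup]
  simp [Nat.factorial]

theorem not_isSolvable_alternatingGroup_five :
    ¬ Group.IsSolvable (alternatingGroup (Fin 5)) := by
  have : IsSimpleGroup (alternatingGroup (Fin 5)) := alternatingGroup.isSimpleGroup (by simp)
  rw [← IsSimpleGroup.comm_iff_isSolvable]
  intro h
  let _ : CommGroup (alternatingGroup (Fin 5)) := { mul_comm := h }
  have := IsSimpleGroup.prime_card (α := alternatingGroup (Fin 5))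
  rw [card_alternatingGroup_five] at this
  norm_num at this

theorem isSolvable_of_isMulCommutative {G : Type*} [Group G] (h : IsMulCommutative G) :
    Group.IsSolvable G := Group.isSolvable_of_comm h.is_comm.comm

/-- There are one or four Sylow 3-subgroups. If four, they are self-normalizing and Burnside gives a
normal subgroup of order 4. A normal subgroup of order 3 or 4 is abelian with abelian quotient. -/
theorem isSolvable_of_card_twelve {G : Type*} [Group G] [Finite G] (h12 : Nat.card G = 12) :
    Group.IsSolvable G := by
  have key (K : Subgroup G) (hn : K.Normal) (hK : Nat.card K = 3 ∨ Nat.card K = 4) :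
      Group.IsSolvable G := by
    have hi := card_mul_index K
    rw [h12] at hi
    change _ * Nat.card (G ⧸ K) = _ at hi
    rw [Group.isSolvable_iff_subgroup_quotient K]
    obtain hK | hK := hK
    · exact ⟨isSolvable_of_isMulCommutative (isMulCommutative_of_card_prime (p := 3) hK),
        isSolvable_of_isMulCommutative
          (IsPGroup.isMulCommutative_of_card_eq_prime_sq (p := 2) (by rw [hK] at hi; omega))⟩
    · have := isCyclic_of_prime_card (α := G ⧸ K) (p := 3) (by rw [hK] at hi; omega)
      exact ⟨isSolvable_of_isMulCommutative (isMulCommutative_of_card_four hK),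
        isSolvable_of_isMulCommutative inferInstance⟩
  obtain ⟨H, hH⟩ := Sylow.exists_subgroup_card_pow_prime (G := G) 3 (n := 1)
    (by rw [h12]; norm_num)
  obtain ⟨R, hR⟩ := (IsPGroup.of_card hH).exists_le_sylow
  have hR3 : Nat.card R = 3 := by
    obtain ⟨n, hn⟩ := R.2.exists_card_eq
    have h1 : Nat.card R ∣ 12 := h12 ▸ card_subgroup_dvd_card (R : Subgroup G)
    have h2 := card_dvd_of_le hR
    rw [hH] at h2
    rw [hn] at h1 h2 ⊢
    obtain _ | _ | n := n
    · norm_num at h2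
    · rfl
    · have : 3 ^ 2 ∣ 12 := (pow_dvd_pow 3 (by omega)).trans h1
      norm_num at this
  have hc : IsMulCommutative (R : Subgroup G) := isMulCommutative_of_card_prime (p := 3) hR3
  have hm : Nat.card (Sylow 3 G) % 3 = 1 := card_sylow_modEq_one 3 G
  have h := card_sylow_mul_card_normalizer R
  obtain ⟨k, hk⟩ := dvd_card_of_le hR3 (le_normalizer (H := (R : Subgroup G)))
  rw [Sylow.coe_coe] at hk
  have h4 : Nat.card (Sylow 3 G) ∣ 4 := ⟨k, by rw [hk, h12] at h; nlinarith⟩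
  obtain h' | h' | h' := dvd_four h4
  · have : Subsingleton (Sylow 3 G) := (Nat.card_eq_one_iff_unique.mp h').1
    exact key R R.normal_of_subsingleton (Or.inl hR3)
  · omega
  · have he : (R : Subgroup G) = normalizer (R : Set G) :=
      eq_of_le_of_card_eq le_normalizer (by rw [h', h12] at h; omega)
    obtain ⟨K, hn, hK⟩ := exists_normal_card_mul R (he.symm.le.trans R.le_centralizer)
    exact key K hn (Or.inr (by rw [h12, hR3] at hK; omega))

theorem card_sylow_five_of_not_isSolvable {G : Type*} [Group G] [Finite G]
    (h60 : Nat.card G = 60) (hG : ¬ Group.IsSolvable G) : Nat.card (Sylow 5 G) = 6 := by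
  refine (card_sylow_five_eq h60).resolve_left fun h => hG ?_
  obtain ⟨Q⟩ : Nonempty (Sylow 5 G) := inferInstance
  have hQ := card_sylow_five h60 Q
  have : Subsingleton (Sylow 5 G) := (Nat.card_eq_one_iff_unique.mp h).1
  have := Q.normal_of_subsingleton
  rw [Group.isSolvable_iff_subgroup_quotient (Q : Subgroup G)]
  refine ⟨isSolvable_of_isMulCommutative (isMulCommutative_of_card_prime (p := 5) hQ),
    isSolvable_of_card_twelve ?_⟩
  have hi := card_mul_index (Q : Subgroup G)
  rw [h60, hQ] at hi
  change Subgroup.index _ = _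
  omega

theorem imCard_alternatingGroup_five : imCard (alternatingGroup (Fin 5)) = 8 := by
  refine imCard_of_card_sylow_five card_alternatingGroup_five
    (card_sylow_five_of_not_isSolvable card_alternatingGroup_five
      not_isSolvable_alternatingGroup_five) fun H hH => ?_
  have : IsSimpleGroup (alternatingGroup (Fin 5)) := alternatingGroup.isSimpleGroup (by simp)
  -- A subgroup of order 30 would be normal, against simplicity.
  have hi : H.index = 2 := by
    have := index_mul_card H
    rw [hH, card_alternatingGroup_five] at this
    omega
  obtain rfl | rfl := (normal_of_index_eq_two hi).eq_bot_or_eq_top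
  · rw [card_bot] at hH
    omega
  · rw [index_top] at hi
    omega

theorem imCard_of_card_sylow_five_eq_six {G : Type*} [Group G] [Finite G]
    (h60 : Nat.card G = 60) (h6 : Nat.card (Sylow 5 G) = 6) : imCard G = 8 := by
  obtain ⟨e⟩ := nonempty_mulEquiv_alternatingGroup h60 h6
  rw [imCard_congr e, imCard_alternatingGroup_five]

end AlternatingGroup

/-! ### Nilpotent groups of order 60 -/

section Nilpotent

variable {G : Type*} [Group G]

theorem measure_of_isMulCommutative [IsMulCommutative G] (H : Subgroup G) :
    measure G H = Nat.card H * Nat.card G := by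
  have : centralizer (H : Set G) = ⊤ := by
    rw [eq_top_iff]
    intro g _ h _
    exact mul_comm' h g
  rw [measure, this, card_top]

theorem imCard_le_of_isMulCommutative [IsMulCommutative G] (h60 : Nat.card G = 60) :
    imCard G ≤ 12 := by
  refine (imCard_le (({1, 2, 3, 4, 5, 6, 10, 12, 15, 20, 30, 60} : Finset ℕ).image (· * 60))
    fun H => Finset.mem_image.mpr ⟨_, card_subgroup_mem h60 H, ?_⟩).trans (by decide)
  rw [measure_of_isMulCommutative, h60]

theorem imCard_of_isCyclic [IsCyclic G] (h60 : Nat.card G = 60) : imCard G = 12 := by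
  refine (imCard_eq (({1, 2, 3, 4, 5, 6, 10, 12, 15, 20, 30, 60} : Finset ℕ).image (· * 60))
    (fun H => Finset.mem_image.mpr ⟨_, card_subgroup_mem h60 H, ?_⟩) (fun m hm => ?_)).trans
    (by decide)
  · rw [measure_of_isMulCommutative, h60]
  · obtain ⟨d, hd, rfl⟩ := Finset.mem_image.mp hm
    have hd : d ∣ 60 := by
      have : ∀ d ∈ ({1, 2, 3, 4, 5, 6, 10, 12, 15, 20, 30, 60} : Finset ℕ), d ∣ 60 := by decide
      exact this d hd
    obtain ⟨g, hg⟩ := IsCyclic.exists_ofOrder_eq_natCard (α := G)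
    refine ⟨zpowers (g ^ (60 / d)), ?_⟩
    have hd0 : 60 / d ≠ 0 := (Nat.div_pos (Nat.le_of_dvd (by norm_num) hd)
      (Nat.pos_of_dvd_of_pos hd (by norm_num))).ne'
    rw [measure_of_isMulCommutative, h60, Nat.card_zpowers, orderOf_pow_of_dvd hd0, hg, h60,
      Nat.div_div_self hd (by norm_num)]
    rw [hg, h60]
    exact Nat.div_dvd_of_dvd hd

/-- The group is the product of its Sylow subgroups, whose orders 4, 3 and 5 force them to be
abelian. -/
theorem isMulCommutative_of_isNilpotent [Finite G] (h60 : Nat.card G = 60)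
    [hG : Group.IsNilpotent G] : IsMulCommutative G := by
  obtain ⟨e⟩ := ((Group.isNilpotent_of_finite_tfae (G := G)).out 0 4).mp hG
  have key (p : (Nat.card G).primeFactors) (P : Sylow p G) : IsMulCommutative P := by
    obtain ⟨p, hp⟩ := p
    rw [Nat.mem_primeFactors, h60] at hp
    have h : p ∈ Nat.primeFactors 60 := Nat.mem_primeFactors.mpr hp
    rw [show Nat.primeFactors 60 = {2, 3, 5} by decide +kernel] at h
    simp only [Finset.mem_insert, Finset.mem_singleton] at h
    obtain rfl | rfl | rfl := h
    · exact isMulCommutative_of_card_four (card_sylow_two h60 P)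
    · exact isMulCommutative_of_card_prime (p := 3) (card_sylow_three h60 P)
    · exact isMulCommutative_of_card_prime (p := 5) (card_sylow_five h60 P)
  refine ⟨⟨fun a b => ?_⟩⟩
  obtain ⟨x, rfl⟩ := e.surjective a
  obtain ⟨y, rfl⟩ := e.surjective b
  rw [← map_mul, ← map_mul]
  congr 1
  ext p P : 2
  exact (key p P).is_comm.comm _ _

end Nilpotent

/-! ### Centralizers of cyclic normal subgroups -/

section Centralizer

variable {G : Type*} [Group G]

theorem ker_conjNormal (N : Subgroup G) [N.Normal] :
    (MulAut.conjNormal : G →* MulAut N).ker = centralizer (N : Set G) := by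
  ext g
  rw [MonoidHom.mem_ker, mem_centralizer_iff]
  constructor
  · intro h x hx
    have := congrArg (fun φ : MulAut N => (φ ⟨x, hx⟩ : G)) h
    simp only [MulAut.conjNormal_apply, MulAut.one_apply] at this
    rw [mul_inv_eq_iff_eq_mul] at this
    exact this.symm
  · intro h
    ext x
    rw [MulAut.conjNormal_apply, ← h x x.2, mul_inv_cancel_right, MulAut.one_apply]

/-- Conjugation embeds `G / C(N)` in `Aut N`, of order `φ(|N|)`. -/
theorem index_centralizer_dvd_totient [Finite G] (N : Subgroup G) [N.Normal] [IsCyclic N] :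
    (centralizer (N : Set G)).index ∣ Nat.totient (Nat.card N) := by
  rw [← ker_conjNormal, index_ker, ← IsCyclic.card_mulAut]
  exact card_subgroup_dvd_card _

theorem le_centralizer_of_coprime_totient [Finite G] (N H : Subgroup G) [N.Normal] [IsCyclic N]
    (h : (Nat.card H).Coprime (Nat.totient (Nat.card N))) : H ≤ centralizer (N : Set G) := by
  rw [← relIndex_eq_one]
  exact Nat.eq_one_of_dvd_coprimes h (relIndex_dvd_card _ _)
    ((relIndex_dvd_index_of_normal _ _).trans (index_centralizer_dvd_totient N))

theorem centralizer_sup (H K : Subgroup G) :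
    centralizer ((H ⊔ K : Subgroup G) : Set G) = centralizer (H : Set G) ⊓ centralizer K := by
  apply le_antisymm
  · exact le_inf (centralizer_le (SetLike.coe_subset_coe.mpr le_sup_left))
      (centralizer_le (SetLike.coe_subset_coe.mpr le_sup_right))
  · rw [le_centralizer_iff]
    exact sup_le (le_centralizer_iff.mp inf_le_left) (le_centralizer_iff.mp inf_le_right)

end Centralizer

/-! ### Normal Sylow 5-subgroup, non-normal Sylow 3-subgroups -/

section SylowThreeNotNormal

variable {G : Type*} [Group G] [Finite G] (h60 : Nat.card G = 60)
  (Q : Sylow 5 G) [hQ : (Q : Subgroup G).Normal]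

include h60 hQ in
theorem sylow_three_le_centralizer_sylow_five (R : Sylow 3 G) :
    (R : Subgroup G) ≤ centralizer (Q : Set G) := by
  have := isCyclic_of_prime_card (card_sylow_five h60 Q)
  apply le_centralizer_of_coprime_totient (Q : Subgroup G)
  rw [card_sylow_five h60 Q, card_sylow_three h60 R]
  decide

variable (h3 : Nat.card (Sylow 3 G) ≠ 1)
include h60 hQ h3

/-- Both `R` and `Q` centralize `R`, so 15 divides `|C(R)|`. The number of Sylow 3-subgroups
therefore divides 4, and it must be 4. -/
theorem card_normalizer_three_eq_fifteen (R : Sylow 3 G) :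
    Nat.card (normalizer (R : Set G)) = 15 ∧ Nat.card (centralizer (R : Set G)) = 15 := by
  have hR := card_sylow_three h60 R
  have hc : IsMulCommutative (R : Subgroup G) := isMulCommutative_of_card_prime (p := 3) hR
  have h1 := dvd_card_of_le hR R.le_centralizer
  have h2 := dvd_card_of_le (card_sylow_five h60 Q)
    (le_centralizer_iff.mp (sylow_three_le_centralizer_sylow_five h60 Q R))
  have hle := card_dvd_of_le (centralizer_le_normalizer (R : Set G))
  have hm : Nat.card (Sylow 3 G) % 3 = 1 := card_sylow_modEq_one 3 G
  have h := card_sylow_mul_card_normalizer R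
  rw [Sylow.coe_coe] at h1 h2
  obtain ⟨k, hk⟩ := ((show Nat.Coprime 3 5 by norm_num).mul_dvd_of_dvd_of_dvd h1 h2).trans hle
  obtain h4 | h4 | h4 := dvd_four (n := Nat.card (Sylow 3 G)) ⟨k, by rw [hk, h60] at h; nlinarith⟩
  · exact absurd h4 h3
  · omega
  · rw [h4, h60] at h
    have h15 : Nat.card (normalizer (R : Set G)) = 15 := by omega
    rw [h15] at hle
    have := Nat.le_of_dvd (by norm_num) hle
    have : 0 < Nat.card (centralizer (R : Set G)) := Nat.card_pos
    omega

theorem four_dvd_card_of_normal (K : Subgroup G) [K.Normal] (hK : 3 ∣ Nat.card K) :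
    4 ∣ Nat.card K := by
  obtain ⟨R, hR⟩ := exists_sylow_three_le h60 K hK
  have h := card_mul_card_normalizer K R hR
  rw [(card_normalizer_three_eq_fifteen h60 Q h3 R).1, h60] at h
  omega

/-- `C(Q)` is normal with order divisible by 3 and 5; Frattini's argument then supplies the factor
4. -/
theorem centralizer_sylow_five_eq_top : centralizer (Q : Set G) = ⊤ := by
  obtain ⟨R⟩ : Nonempty (Sylow 3 G) := inferInstance
  have hcQ : IsMulCommutative (Q : Subgroup G) :=
    isMulCommutative_of_card_prime (p := 5) (card_sylow_five h60 Q)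
  have h1 := dvd_card_of_le (card_sylow_three h60 R)
    (sylow_three_le_centralizer_sylow_five h60 Q R)
  have h2 := dvd_card_of_le (card_sylow_five h60 Q) Q.le_centralizer
  have h4 := four_dvd_card_of_normal h60 Q h3 (centralizer ((Q : Subgroup G) : Set G)) h1
  apply eq_top_of_card_eq
  rw [Sylow.coe_coe] at h2 h4
  have := card_subgroup_dvd_sixty h60 (centralizer (Q : Set G))
  have := Nat.le_of_dvd (by norm_num) this
  have : 0 < Nat.card (centralizer (Q : Set G)) := Nat.card_pos
  omega

theorem two_dvd_imp_card_centralizer_ne (K : Subgroup G) (hK : 2 ∣ Nat.card K) :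
    Nat.card (centralizer (K : Set G)) ≠ 60 := by
  intro h
  obtain ⟨R⟩ : Nonempty (Sylow 3 G) := inferInstance
  have hle : (R : Subgroup G) ≤ centralizer (K : Set G) := by
    rw [eq_top_of_card_eq _ (h.trans h60.symm)]
    exact le_top
  replace hle := le_centralizer_iff.mp hle
  have := hK.trans (card_dvd_of_le hle)
  rw [Sylow.coe_coe, (card_normalizer_three_eq_fifteen h60 Q h3 R).2] at this
  omega

/-- As `Q` is central, `H` and `HQ` have the same centralizer, and `|H|` is `|HQ|` or `|HQ| / 5`.
Six possible pairs for `HQ` give twelve products, and (5, 60) and (60, 5) give the same two. -/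
theorem imCard_le_ten_of_card_sylow_three : imCard G ≤ 10 := by
  have hQc := centralizer_sylow_five_eq_top h60 Q h3
  have hQ5 := card_sylow_five h60 Q
  have hCs (H : Subgroup G) :
      centralizer ((H ⊔ Q : Subgroup G) : Set G) = centralizer (H : Set G) := by
    rw [centralizer_sup, Sylow.coe_coe, hQc, inf_top_eq]
  have h5 (H : Subgroup G) : 5 ∣ Nat.card (centralizer (H : Set G)) :=
    dvd_card_of_le hQ5 (le_centralizer_iff.mp (by rw [Sylow.coe_coe, hQc]; exact le_top))
  have key (K : Subgroup G) (hK : (Q : Subgroup G) ≤ K) :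
      (Nat.card K, Nat.card (centralizer (K : Set G))) ∈ ({(5, 60), (10, 20), (15, 15), (20, 20),
        (60, 5), (60, 15)} : Finset (ℕ × ℕ)) := by
    have hK5 := dvd_card_of_le hQ5 hK
    have hc5 := h5 K
    have hn := two_dvd_imp_card_centralizer_ne h60 Q h3 K
    have h3' (h : 3 ∣ Nat.card K) : Nat.card (centralizer (K : Set G)) ∣ 15 := by
      obtain ⟨R, hR⟩ := exists_sylow_three_le h60 K h
      rw [← (card_normalizer_three_eq_fifteen h60 Q h3 R).2]
      exact card_dvd_of_le (centralizer_le hR)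
    -- Here `K = LQ` with `L` a 2-group, so `C(K) = C(L)` contains an abelian Sylow 2-subgroup
    -- around `L`.
    have h2 (n : ℕ) (h : Nat.card K = 2 ^ n * 5) : 4 ∣ Nat.card (centralizer (K : Set G)) := by
      obtain ⟨L, hLK, hL⟩ : ∃ L ≤ K, Nat.card L = 2 ^ n := by
        obtain ⟨L, hL⟩ := Sylow.exists_subgroup_card_pow_prime (G := K) 2 (n := n)
          (by rw [h]; exact dvd_mul_right _ _)
        refine ⟨L.map K.subtype, map_subtype_le L, ?_⟩
        rw [← hL]
        exact Nat.card_congr (L.equivMapOfInjective _ K.subtype_injective).symm.toEquiv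
      have hs := card_sup_of_coprime L (Q : Subgroup G) (by
        rw [hL, hQ5]; exact Nat.Coprime.pow_left _ (by norm_num))
      rw [← eq_of_le_of_card_eq (sup_le hLK hK) (by rw [hs, hL, hQ5, h]), hCs]
      exact four_dvd_card_centralizer_of_isPGroup h60 L (IsPGroup.of_card hL)
    have h15 (h : Nat.card K = 15) : 3 ∣ Nat.card (centralizer (K : Set G)) := by
      obtain ⟨R, hR⟩ := exists_sylow_three_le h60 K (by omega)
      have hR3 := card_sylow_three h60 R
      have hc : IsMulCommutative (R : Subgroup G) := isMulCommutative_of_card_prime (p := 3) hR3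
      have hs := card_sup_of_coprime (R : Subgroup G) (Q : Subgroup G)
        (by rw [hR3, hQ5]; norm_num)
      rw [← eq_of_le_of_card_eq (sup_le hR hK) (by rw [hs, hR3, hQ5, h]), hCs]
      exact dvd_card_of_le hR3 R.le_centralizer
    have h30 : Nat.card K ≠ 30 := fun h => by
      have hi : K.index = 2 := by
        have := index_mul_card K
        rw [h, h60] at this
        omega
      have := normal_of_index_eq_two hi
      have := four_dvd_card_of_normal h60 Q h3 K (by omega)
      omega
    have hQK (h : Nat.card K = 5) : Nat.card (centralizer (K : Set G)) = 60 := by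
      rw [← eq_of_le_of_card_eq hK (hQ5.trans h.symm), Sylow.coe_coe, hQc, card_top, h60]
    have h2' (h : Nat.card K = 10) := h2 1 h
    have h4' (h : Nat.card K = 20) := h2 2 h
    have hm := card_subgroup_mem h60 K
    have hm' := card_subgroup_mem h60 (centralizer (K : Set G))
    simp only [Finset.mem_insert, Finset.mem_singleton] at hm hm'
    replace h3' (h : 3 ∣ Nat.card K) : Nat.card (centralizer (K : Set G)) = 5 ∨
        Nat.card (centralizer (K : Set G)) = 15 := by
      obtain ⟨k, hk⟩ := hc5
      have := h3' h
      rw [hk] at this ⊢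
      have := (Nat.dvd_prime Nat.prime_three).mp (Nat.dvd_of_mul_dvd_mul_left
        (show 0 < 5 by norm_num) (show 5 * k ∣ 5 * 3 from this))
      omega
    simp only [Finset.mem_insert, Finset.mem_singleton, Prod.mk.injEq]
    clear h2
    generalize Nat.card (centralizer (K : Set G)) = c at *
    generalize Nat.card K = n at *
    obtain h | h | h | h | h | h | h | h | h | h | h | h := hm <;> subst h
    · norm_num at hK5
    · norm_num at hK5
    · norm_num at hK5
    · norm_num at hK5
    · simp [hQK rfl]
    · norm_num at hK5
    · simp [show c = 20 by omega]
    · norm_num at hK5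
    · simp [show c = 15 by omega]
    · simp [show c = 20 by omega]
    · exact absurd rfl h30
    · simpa using h3' (by norm_num)
  refine (imCard_le {300, 60, 200, 40, 225, 45, 400, 80, 900, 180} fun H => ?_).trans (by decide)
  have hk := key (H ⊔ Q) le_sup_right
  have hs := card_sup_mul_card_inf H (Q : Subgroup G)
  have hi := (Nat.dvd_prime Nat.prime_five).mp
    (hQ5 ▸ card_dvd_of_le (inf_le_right : H ⊓ (Q : Subgroup G) ≤ Q))
  rw [hQ5] at hs
  rw [hCs] at hk
  simp only [Finset.mem_insert, Finset.mem_singleton, Prod.mk.injEq] at hk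
  rw [measure]
  have hH : Nat.card H = Nat.card (H ⊔ Q : Subgroup G) ∨
      5 * Nat.card H = Nat.card (H ⊔ Q : Subgroup G) := by
    obtain hi | hi := hi <;> rw [hi] at hs <;> omega
  generalize Nat.card (H ⊔ Q : Subgroup G) = k at *
  clear hs hi
  obtain ⟨rfl, h⟩ | ⟨rfl, h⟩ | ⟨rfl, h⟩ | ⟨rfl, h⟩ | ⟨rfl, h⟩ | ⟨rfl, h⟩ := hk <;> rw [h] <;>
    obtain hH | hH := hH
  · simp [hH]
  · simp [show Nat.card H = 1 by omega]
  · simp [hH]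
  · simp [show Nat.card H = 2 by omega]
  · simp [hH]
  · simp [show Nat.card H = 3 by omega]
  · simp [hH]
  · simp [show Nat.card H = 4 by omega]
  · simp [hH]
  · simp [show Nat.card H = 12 by omega]
  · simp [hH]
  · simp [show Nat.card H = 12 by omega]

end SylowThreeNotNormal

/-! ### Product formula for an abelian normal Hall subgroup -/

section ProductFormula

variable {G : Type*} [Group G] [Finite G]

theorem sup_eq_top_of_index_eq_pow {p k : ℕ} [Fact p.Prime] (N : Subgroup G)
    (hk : N.index = p ^ k) (P : Sylow p G) : (P : Subgroup G) ⊔ N = ⊤ := by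
  rw [← index_eq_one]
  refine Nat.eq_one_of_dvd_coprimes ?_
    (index_dvd_of_le (le_sup_left : (P : Subgroup G) ≤ (P : Subgroup G) ⊔ N))
    (hk ▸ index_dvd_of_le (le_sup_right : N ≤ (P : Subgroup G) ⊔ N))
  exact (((Nat.Prime.coprime_iff_not_dvd Fact.out).mpr P.not_dvd_index).symm).pow_right k

/-- Write `H = (H ∩ N)Q` with `Q` inside an abelian Sylow subgroup `P`, and `G = PN`. If `yz` with
`y ∈ P`, `z ∈ N` centralizes `H ∩ N`, so does `y`; as `y` also centralizes `Q`, it lies in `C(H)`.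
-/
theorem centralizer_sup_eq_centralizer_inf {p k : ℕ} [Fact p.Prime] (N : Subgroup G) [N.Normal]
    [IsMulCommutative N] (hcop : (Nat.card N).Coprime N.index) (hk : N.index = p ^ k)
    (hP : ∀ P : Sylow p G, IsMulCommutative P) (H : Subgroup G) :
    centralizer (H : Set G) ⊔ N = centralizer ((H ⊓ N : Subgroup G) : Set G) := by
  have hN : N ≤ centralizer ((H ⊓ N : Subgroup G) : Set G) :=
    N.le_centralizer.trans (centralizer_le (SetLike.coe_subset_coe.mpr inf_le_right))
  refine le_antisymm (sup_le (centralizer_le (SetLike.coe_subset_coe.mpr inf_le_left)) hN) ?_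
  intro x hx
  obtain ⟨Q, hQH, hQ, hQc⟩ := exists_complement_inf N hcop H
  have hQp : IsPGroup p Q := by
    have : N.relIndex H ∣ p ^ k := hk ▸ relIndex_dvd_index_of_normal N H
    obtain ⟨i, -, hi⟩ := (Nat.dvd_prime_pow Fact.out).mp this
    exact IsPGroup.of_card (hQc.trans hi)
  obtain ⟨P, hQP⟩ := hQp.exists_le_sylow
  have hPN : x ∈ (P : Subgroup G) ⊔ N := by
    rw [sup_eq_top_of_index_eq_pow N hk P]
    exact mem_top x
  obtain ⟨y, hy, z, hz, rfl⟩ := mem_sup_of_normal_right.mp hPN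
  refine mul_mem (mem_sup_left ?_) (mem_sup_right hz)
  have h1 : y ∈ centralizer ((H ⊓ N : Subgroup G) : Set G) := by
    simpa using mul_mem hx (inv_mem (hN hz))
  have := hP P
  have h2 : y ∈ centralizer (Q : Set G) :=
    centralizer_le (SetLike.coe_subset_coe.mpr hQP) ((P : Subgroup G).le_centralizer hy)
  rw [← hQ, centralizer_sup]
  exact ⟨h1, h2⟩

/-- The contribution of an overgroup of an abelian normal subgroup to the measure. -/
noncomputable def upperMeasure (N L : Subgroup G) : ℕ :=
  Nat.card L * Nat.card (N ⊓ centralizer (L : Set G) : Subgroup G)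

/-- The measure of `H` is determined by its intersection and its join with an abelian normal Hall
subgroup. -/
theorem card_sq_mul_measure {p k : ℕ} [Fact p.Prime] (N : Subgroup G) [N.Normal]
    [IsMulCommutative N] (hcop : (Nat.card N).Coprime N.index) (hk : N.index = p ^ k)
    (hP : ∀ P : Sylow p G, IsMulCommutative P) (H : Subgroup G) :
    Nat.card N ^ 2 * measure G H = measure G (H ⊓ N) * upperMeasure N (H ⊔ N) := by
  have h1 := card_sup_mul_card_inf H N
  have h2 := card_sup_mul_card_inf (centralizer (H : Set G)) N
  rw [centralizer_sup_eq_centralizer_inf N hcop hk hP] at h2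
  have h3 : N ⊓ centralizer ((H ⊔ N : Subgroup G) : Set G) = centralizer (H : Set G) ⊓ N := by
    rw [centralizer_sup, inf_left_comm, inf_eq_left.mpr N.le_centralizer]
  rw [upperMeasure, h3, measure, measure]
  -- The order formulas for `HN` and for `C(H)N = C(H ∩ N)` are multiplied together.
  calc _ = (Nat.card H * Nat.card N) * (Nat.card (centralizer (H : Set G)) * Nat.card N) := by ring
    _ = _ := by rw [← h1, ← h2]; ring

/-- Take `H = QD` with `Q` a complement of `N` in `L`. Hence the two factors of the product formula
can be prescribed independently when `D` is normal. -/
theorem exists_inf_eq_sup_eq (N D L : Subgroup G) [N.Normal] [D.Normal]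
    (hcop : (Nat.card N).Coprime N.index) (hD : D ≤ N) (hL : N ≤ L) :
    ∃ H : Subgroup G, H ⊓ N = D ∧ H ⊔ N = L := by
  obtain ⟨Q, hQL, hQ, hQc⟩ := exists_complement_inf N hcop L
  rw [inf_eq_right.mpr hL, sup_comm] at hQ
  have hs : Q ⊔ D ⊔ N = L := by rw [sup_assoc, sup_eq_right.mpr hD, hQ]
  refine ⟨Q ⊔ D, ?_, hs⟩
  have hQN : (Nat.card Q).Coprime (Nat.card N) :=
    (hcop.coprime_dvd_right (hQc ▸ relIndex_dvd_index_of_normal N L)).symm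
  have h1 := card_sup_mul_card_inf (Q ⊔ D) N
  have h2 := card_sup_of_coprime Q N hQN
  rw [card_sup_of_coprime Q D (hQN.coprime_dvd_right (card_dvd_of_le hD)), hs, ← hQ, h2] at h1
  refine (eq_of_le_of_card_eq (le_inf le_sup_right hD) ?_).symm
  have : 0 < Nat.card Q * Nat.card N := Nat.mul_pos Nat.card_pos Nat.card_pos
  refine Nat.eq_of_mul_eq_mul_left this ?_
  rw [h1]
  ring

end ProductFormula

/-! ### Normal subgroups of orders 3 and 5: counting products -/

section NormalFifteen

variable {G : Type*} [Group G] [Finite G]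

theorem card_sup_fifteen (A B : Subgroup G) [B.Normal] (hA : Nat.card A = 3)
    (hB : Nat.card B = 5) : Nat.card (A ⊔ B : Subgroup G) = 15 := by
  rw [card_sup_of_coprime A B (by rw [hA, hB]; norm_num), hA, hB]

theorem le_centralizer_of_card_three_five (A B : Subgroup G) [B.Normal]
    (hA : Nat.card A = 3) (hB : Nat.card B = 5) : A ≤ centralizer (B : Set G) := by
  have := isCyclic_of_prime_card hB
  apply le_centralizer_of_coprime_totient
  rw [hA, hB]
  decide

theorem sup_le_centralizer_left (A B : Subgroup G) [B.Normal] (hA : Nat.card A = 3)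
    (hB : Nat.card B = 5) : A ⊔ B ≤ centralizer (A : Set G) := by
  have : IsMulCommutative A := isMulCommutative_of_card_prime (p := 3) hA
  exact sup_le A.le_centralizer
    (le_centralizer_iff.mp (le_centralizer_of_card_three_five A B hA hB))

theorem sup_le_centralizer_right (A B : Subgroup G) [B.Normal] (hA : Nat.card A = 3)
    (hB : Nat.card B = 5) : A ⊔ B ≤ centralizer (B : Set G) := by
  have : IsMulCommutative B := isMulCommutative_of_card_prime (p := 5) hB
  exact sup_le (le_centralizer_of_card_three_five A B hA hB) B.le_centralizer

theorem card_mem_of_sup_le (h60 : Nat.card G = 60) (A B : Subgroup G) [B.Normal]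
    (hA : Nat.card A = 3) (hB : Nat.card B = 5) (L : Subgroup G) (hL : A ⊔ B ≤ L) :
    Nat.card L = 15 ∨ Nat.card L = 30 ∨ Nat.card L = 60 := by
  have h15 := dvd_card_of_le (card_sup_fifteen A B hA hB) hL
  have hm := card_subgroup_mem h60 L
  simp only [Finset.mem_insert, Finset.mem_singleton] at hm
  obtain h | h | h | h | h | h | h | h | h | h | h | h := hm <;> rw [h] at h15 ⊢ <;> omega

theorem isMulCommutative_sup (A B : Subgroup G) [B.Normal] (hA : Nat.card A = 3)
    (hB : Nat.card B = 5) : IsMulCommutative (A ⊔ B : Subgroup G) := by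
  rw [← le_centralizer_iff_isMulCommutative, centralizer_sup]
  exact le_inf (sup_le_centralizer_left A B hA hB) (sup_le_centralizer_right A B hA hB)

variable (h60 : Nat.card G = 60) (A B : Subgroup G) [A.Normal] [B.Normal]
  (hA : Nat.card A = 3) (hB : Nat.card B = 5)

include h60

/-- Otherwise `DK` has order `p²`, which does not divide 60 for `p > 2`. -/
theorem eq_of_normal_of_card_prime {p : ℕ} [hp : Fact p.Prime] (hp2 : 2 < p) (K : Subgroup G)
    [K.Normal] (hK : Nat.card K = p) (D : Subgroup G) (hD : Nat.card D = p) : D = K := by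
  have h := card_sup_mul_card_inf D K
  have hi : Nat.card (D ⊓ K : Subgroup G) ∣ p := hK ▸ card_dvd_of_le inf_le_right
  obtain hi | hi := (Nat.dvd_prime Fact.out).mp hi
  · rw [hi, mul_one, hD, hK] at h
    have h1 : p * p ∣ 60 := h ▸ card_subgroup_dvd_sixty h60 _
    have h2 := Nat.le_of_dvd (by norm_num) h1
    have h3 : p ≤ 7 := by nlinarith
    interval_cases p <;> omega
  · have h1 := eq_of_le_of_card_eq (inf_le_left : D ⊓ K ≤ D) (hi.trans hD.symm)
    have h2 := eq_of_le_of_card_eq (inf_le_right : D ⊓ K ≤ K) (hi.trans hK.symm)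
    rw [← h1, h2]

include hA hB

theorem measure_mul_eq (H : Subgroup G) :
    225 * measure G H = measure G (H ⊓ (A ⊔ B)) * upperMeasure (A ⊔ B) (H ⊔ (A ⊔ B)) := by
  have hN := card_sup_fifteen A B hA hB
  have := isMulCommutative_sup A B hA hB
  have hi : (A ⊔ B).index = 2 ^ 2 := by
    have := index_mul_card (A ⊔ B)
    rw [hN, h60] at this
    omega
  have h := card_sq_mul_measure (p := 2) (A ⊔ B) (by rw [hN, hi]; norm_num) hi
    (fun P => isMulCommutative_of_card_four (card_sylow_two h60 P)) H
  rwa [hN] at h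

theorem measure_mem_of_le (D : Subgroup G) (hD : D ≤ A ⊔ B) :
    measure G D ∈ ({60, 3 * Nat.card (centralizer (A : Set G)),
      5 * Nat.card (centralizer (B : Set G)),
      15 * Nat.card (centralizer (A : Set G) ⊓ centralizer B : Subgroup G)} : Finset ℕ) := by
  have hN := card_sup_fifteen A B hA hB
  have hd := card_dvd_of_le hD
  have hm := card_subgroup_mem h60 D
  rw [hN] at hd
  simp only [Finset.mem_insert, Finset.mem_singleton] at hm ⊢
  have : Nat.card D = 1 ∨ Nat.card D = 3 ∨ Nat.card D = 5 ∨ Nat.card D = 15 := by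
    obtain h | h | h | h | h | h | h | h | h | h | h | h := hm <;> rw [h] at hd ⊢ <;> omega
  obtain h | h | h | h := this
  · left
    rw [card_eq_one.mp h, measure, centralizer_eq_top_iff_subset.mpr (by simp), card_top, h60,
      card_bot]
  · right; left
    rw [eq_of_normal_of_card_prime h60 (by norm_num) A hA D h, measure, hA]
  · right; right; left
    rw [eq_of_normal_of_card_prime h60 (by norm_num) B hB D h, measure, hB]
  · right; right; right
    rw [eq_of_le_of_card_eq hD (h.trans hN.symm), measure, hN, centralizer_sup]

theorem imCard_le_card_image (F U : Finset ℕ)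
    (hF : ∀ D ≤ A ⊔ B, measure G D ∈ F) (hU : ∀ L, A ⊔ B ≤ L → upperMeasure (A ⊔ B) L ∈ U) :
    imCard G ≤ ((F ×ˢ U).image fun x => x.1 * x.2 / 225).card := by
  refine imCard_le _ fun H => Finset.mem_image.mpr ⟨(_, _), Finset.mk_mem_product
    (hF _ (inf_le_right : H ⊓ (A ⊔ B) ≤ _)) (hU _ (le_sup_right : _ ≤ H ⊔ (A ⊔ B))), ?_⟩
  dsimp only
  rw [← measure_mul_eq h60 A B hA hB, Nat.mul_div_cancel_left _ (by norm_num)]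

/-- If a Sylow `2`-subgroup is cyclic, there are at most three overgroups of the normal Hall
subgroup. -/
theorem imCard_le_twelve_of_orderOf_eq_four (y : G) (hy : orderOf y = 4) : imCard G ≤ 12 := by
  have hN := card_sup_fifteen A B hA hB
  refine (imCard_le_card_image h60 A B hA hB _ {upperMeasure (A ⊔ B) (A ⊔ B),
    upperMeasure (A ⊔ B) (A ⊔ B ⊔ zpowers (y ^ 2)), upperMeasure (A ⊔ B) ⊤}
    (measure_mem_of_le h60 A B hA hB) fun L hL => ?_).trans
    (Finset.card_image_le.trans ?_)
  · simp only [Finset.mem_insert, Finset.mem_singleton]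
    obtain h | h | h := card_mem_of_sup_le h60 A B hA hB L hL
    · left
      rw [eq_of_le_of_card_eq hL (hN.trans h.symm)]
    · right; left
      have hi : L.index = 2 := by
        have := index_mul_card L
        rw [h, h60] at this
        omega
      -- A subgroup of index 2 contains all squares, and `y ^ 2` has order 2, so `N` and `y ^ 2`
      -- already generate `L`.
      have hle : A ⊔ B ⊔ zpowers (y ^ 2) ≤ L := by
        refine sup_le hL ?_
        rw [zpowers_le]
        exact sq_mem_of_index_two hi y
      have hne : Nat.card (A ⊔ B ⊔ zpowers (y ^ 2) : Subgroup G) ≠ 15 := by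
        intro h15
        have h2 : Nat.card (zpowers (y ^ 2)) = 2 := by
          rw [Nat.card_zpowers, orderOf_pow_of_dvd (by norm_num) (by rw [hy]; norm_num), hy]
        have := dvd_card_of_le h2 (le_sup_right : _ ≤ A ⊔ B ⊔ zpowers (y ^ 2))
        omega
      have hc := card_mem_of_sup_le h60 A B hA hB _ (le_sup_left : _ ≤ A ⊔ B ⊔ zpowers (y ^ 2))
      have := card_le_of_le hle
      rw [eq_of_le_of_card_eq hle (by omega)]
    · right; right
      rw [eq_top_of_card_eq L (h.trans h60.symm)]
  · rw [Finset.card_product]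
    exact Nat.mul_le_mul Finset.card_le_four Finset.card_le_three

/-- Here `t = |N ∩ C(L)|`. Since `A` and `B` are the only subgroups of their orders, divisibility of
`t` by 3 or 5 detects whether `C(L)` contains them. -/
theorem card_inf_centralizer (L : Subgroup G) :
    ∃ t, upperMeasure (A ⊔ B) L = Nat.card L * t ∧ (t = 1 ∨ t = 3 ∨ t = 5 ∨ t = 15) ∧
      (3 ∣ t ↔ L ≤ centralizer (A : Set G)) ∧ (5 ∣ t ↔ L ≤ centralizer (B : Set G)) := by
  refine ⟨_, rfl, ?_, ⟨fun h => ?_, fun h => ?_⟩, ⟨fun h => ?_, fun h => ?_⟩⟩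
  · have hd : Nat.card ((A ⊔ B) ⊓ centralizer (L : Set G) : Subgroup G) ∣ 15 := by
      rw [← card_sup_fifteen A B hA hB]
      exact card_dvd_of_le inf_le_left
    have hm := card_subgroup_mem h60 ((A ⊔ B) ⊓ centralizer (L : Set G))
    simp only [Finset.mem_insert, Finset.mem_singleton] at hm
    obtain h | h | h | h | h | h | h | h | h | h | h | h := hm <;> rw [h] at hd ⊢ <;> omega
  · obtain ⟨R, hR⟩ := exists_sylow_three_le h60 _ h
    have hRA := eq_of_normal_of_card_prime h60 (by norm_num) A hA R (card_sylow_three h60 R)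
    exact le_centralizer_iff.mp ((hRA ▸ hR).trans inf_le_right)
  · exact dvd_card_of_le hA (le_inf le_sup_left (le_centralizer_iff.mp h))
  · obtain ⟨R, hR⟩ := exists_sylow_five_le h60 _ h
    have hRB := eq_of_normal_of_card_prime h60 (by norm_num) B hB R (card_sylow_five h60 R)
    exact le_centralizer_iff.mp ((hRB ▸ hR).trans inf_le_right)
  · exact dvd_card_of_le hB (le_inf le_sup_right (le_centralizer_iff.mp h))

/-- Collects numerical constraints on an overgroup, so that its possible contributions come from a
finite check. The last two hold because equal orders turn `C(A) ∩ C(B) ≤ C(A)`, or `≤ C(B)`, into an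
equality. -/
theorem exists_upperMeasure_eq (L : Subgroup G) (hL : A ⊔ B ≤ L) {a b n : ℕ}
    (ha : Nat.card (centralizer (A : Set G)) = a) (hb : Nat.card (centralizer (B : Set G)) = b)
    (hn : Nat.card (centralizer (A : Set G) ⊓ centralizer B : Subgroup G) = n) :
    ∃ l t, upperMeasure (A ⊔ B) L = l * t ∧ (l = 15 ∨ l = 30 ∨ l = 60) ∧
      (t = 1 ∨ t = 3 ∨ t = 5 ∨ t = 15) ∧ (l = 15 → t = 15) ∧ (3 ∣ t → l ≤ a) ∧
      (5 ∣ t → l ≤ b) ∧ (15 ∣ t → l ≤ n) ∧ (a = 60 → 3 ∣ t) ∧ (b = 60 → 5 ∣ t) ∧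
      (a = n → 3 ∣ t → 5 ∣ t) ∧ (b = n → 5 ∣ t → 3 ∣ t) := by
  have hN := card_sup_fifteen A B hA hB
  obtain ⟨t, ht, ht', h3, h5⟩ := card_inf_centralizer h60 A B hA hB L
  refine ⟨Nat.card L, t, ht, card_mem_of_sup_le h60 A B hA hB L hL, ht', fun h => ?_, fun h => ?_,
    fun h => ?_, fun h => ?_, fun h => ?_, fun h => ?_, fun h h' => ?_, fun h h' => ?_⟩
  · rw [← eq_of_le_of_card_eq hL (hN.trans h.symm)] at h3 h5
    have := h3.mpr (sup_le_centralizer_left A B hA hB)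
    have := h5.mpr (sup_le_centralizer_right A B hA hB)
    omega
  · rw [← ha]
    exact card_le_of_le (h3.mp h)
  · rw [← hb]
    exact card_le_of_le (h5.mp h)
  · rw [← hn]
    exact card_le_of_le (le_inf (h3.mp (by omega)) (h5.mp (by omega)))
  · rw [h3, eq_top_of_card_eq _ (ha.trans (h.trans h60.symm))]
    exact le_top
  · rw [h5, eq_top_of_card_eq _ (hb.trans (h.trans h60.symm))]
    exact le_top
  · have := eq_of_le_of_card_eq (inf_le_left : centralizer (A : Set G) ⊓
      centralizer (B : Set G) ≤ _) (hn.trans (h.symm.trans ha.symm))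
    exact h5.mpr ((h3.mp h').trans (inf_eq_left.mp this))
  · have := eq_of_le_of_card_eq (inf_le_right : centralizer (A : Set G) ⊓
      centralizer (B : Set G) ≤ _) (hn.trans (h.symm.trans hb.symm))
    exact h3.mpr ((h5.mp h').trans (inf_eq_right.mp this))

theorem imCard_le_card_of_card_centralizer {a b n : ℕ}
    (ha : Nat.card (centralizer (A : Set G)) = a) (hb : Nat.card (centralizer (B : Set G)) = b)
    (hn : Nat.card (centralizer (A : Set G) ⊓ centralizer B : Subgroup G) = n) (U : Finset ℕ)
    (hU : ∀ l t, (l = 15 ∨ l = 30 ∨ l = 60) →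
      (t = 1 ∨ t = 3 ∨ t = 5 ∨ t = 15) → (l = 15 → t = 15) → (3 ∣ t → l ≤ a) →
      (5 ∣ t → l ≤ b) → (15 ∣ t → l ≤ n) → (a = 60 → 3 ∣ t) → (b = 60 → 5 ∣ t) →
      (a = n → 3 ∣ t → 5 ∣ t) → (b = n → 5 ∣ t → 3 ∣ t) → l * t ∈ U) :
    imCard G ≤ ((({60, 3 * a, 5 * b, 15 * n} : Finset ℕ) ×ˢ U).image
      fun x => x.1 * x.2 / 225).card := by
  subst ha hb hn
  refine imCard_le_card_image h60 A B hA hB _ U (measure_mem_of_le h60 A B hA hB) fun L hL => ?_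
  obtain ⟨l, t, h, h1, h2, h3, h4, h5, h6, h7, h8, h9, h10⟩ :=
    exists_upperMeasure_eq h60 A B hA hB L hL rfl rfl rfl
  rw [h]
  exact hU l t h1 h2 h3 h4 h5 h6 h7 h8 h9 h10

/-- The first three configurations give at most 12 values; the last has twenty products with 13
distinct values. -/
theorem imCard_le_thirteen {a b n : ℕ}
    (ha : Nat.card (centralizer (A : Set G)) = a) (hb : Nat.card (centralizer (B : Set G)) = b)
    (hn : Nat.card (centralizer (A : Set G) ⊓ centralizer B : Subgroup G) = n)
    (h : (a = 60 ∧ b = 60 ∧ n = 60) ∨ (a = 60 ∧ b = 30 ∧ n = 30) ∨ (a = 30 ∧ b = 60 ∧ n = 30) ∨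
      (a = 30 ∧ b = 30 ∧ n = 15)) : imCard G ≤ 13 := by
  obtain ⟨rfl, rfl, rfl⟩ | ⟨rfl, rfl, rfl⟩ | ⟨rfl, rfl, rfl⟩ | ⟨rfl, rfl, rfl⟩ := h
  · refine (imCard_le_card_of_card_centralizer h60 A B hA hB ha hb hn {225, 450, 900} ?_).trans
      (by decide)
    rintro l t (rfl | rfl | rfl) (rfl | rfl | rfl | rfl) <;> simp
  · refine (imCard_le_card_of_card_centralizer h60 A B hA hB ha hb hn {225, 450, 90, 180} ?_).trans
      (by decide)
    rintro l t (rfl | rfl | rfl) (rfl | rfl | rfl | rfl) <;> simp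
  · refine (imCard_le_card_of_card_centralizer h60 A B hA hB ha hb hn {225, 450, 150, 300} ?_).trans
      (by decide)
    rintro l t (rfl | rfl | rfl) (rfl | rfl | rfl | rfl) <;> simp
  · refine (imCard_le_card_of_card_centralizer h60 A B hA hB ha hb hn
      {225, 90, 150, 30, 60} ?_).trans (by decide)
    rintro l t (rfl | rfl | rfl) (rfl | rfl | rfl | rfl) <;> simp

section Dihedral

variable (ha : Nat.card (centralizer (A : Set G)) = 30)
  (hb : Nat.card (centralizer (B : Set G)) = 30)
  (hn : Nat.card (centralizer (A : Set G) ⊓ centralizer B : Subgroup G) = 30)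
include ha hb hn

theorem imCard_le_fourteen : imCard G ≤ 14 := by
  refine (imCard_le_card_of_card_centralizer h60 A B hA hB ha hb hn
    {225, 450, 30, 60} ?_).trans (by decide)
  rintro l t (rfl | rfl | rfl) (rfl | rfl | rfl | rfl) <;> simp

/-- For the lower bound, `1, A, B, N` realize the first factors and `N, C(A), N⟨x⟩, G` the second.
As `C(A) = C(B)` omits `x`, the last two overgroups have `t = 1`. -/
theorem imCard_eq_fourteen (x : G) (hx : orderOf x = 2) (hxA : x ∉ centralizer (A : Set G)) :
    imCard G = 14 := by
  have hN := card_sup_fifteen A B hA hB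
  have hNC : A ⊔ B ≤ centralizer (A : Set G) ⊓ centralizer (B : Set G) :=
    le_inf (sup_le_centralizer_left A B hA hB) (sup_le_centralizer_right A B hA hB)
  have hAC := eq_of_le_of_card_eq (inf_le_left : centralizer (A : Set G) ⊓
    centralizer (B : Set G) ≤ _) (hn.trans ha.symm)
  have hBC := eq_of_le_of_card_eq (inf_le_right : centralizer (A : Set G) ⊓
    centralizer (B : Set G) ≤ _) (hn.trans hb.symm)
  have hAB := hAC.symm.trans hBC
  have hi : (A ⊔ B).index = 4 := by
    have := index_mul_card (A ⊔ B)
    rw [hN, h60] at this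
    omega
  have hF (m) (hm : m ∈ ({60, 90, 150, 450} : Finset ℕ)) :
      ∃ D : Subgroup G, D.Normal ∧ D ≤ A ⊔ B ∧ measure G D = m := by
    simp only [Finset.mem_insert, Finset.mem_singleton] at hm
    obtain rfl | rfl | rfl | rfl := hm
    · refine ⟨⊥, inferInstance, bot_le, ?_⟩
      rw [measure, centralizer_eq_top_iff_subset.mpr (by simp), card_top, h60, card_bot]
    · exact ⟨A, inferInstance, le_sup_left, by rw [measure, hA, ha]⟩
    · exact ⟨B, inferInstance, le_sup_right, by rw [measure, hB, hb]⟩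
    · exact ⟨A ⊔ B, inferInstance, le_rfl, by rw [measure, hN, centralizer_sup, hn]⟩
  have hU (m) (hm : m ∈ ({225, 450, 30, 60} : Finset ℕ)) :
      ∃ L : Subgroup G, A ⊔ B ≤ L ∧ upperMeasure (A ⊔ B) L = m := by
    simp only [Finset.mem_insert, Finset.mem_singleton] at hm
    have key (L : Subgroup G) := card_inf_centralizer h60 A B hA hB L
    have hx' (L : Subgroup G) (hL : x ∈ L) : ¬ L ≤ centralizer (A : Set G) :=
      fun h => hxA (h hL)
    obtain rfl | rfl | rfl | rfl := hm
    · obtain ⟨t, ht, h, h3, h5⟩ := key (A ⊔ B)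
      have := h3.mpr (sup_le_centralizer_left A B hA hB)
      have := h5.mpr (sup_le_centralizer_right A B hA hB)
      exact ⟨_, le_rfl, by rw [ht, hN]; omega⟩
    · obtain ⟨t, ht, h, h3, h5⟩ := key (centralizer A ⊓ centralizer B)
      have := h3.mpr inf_le_left
      have := h5.mpr inf_le_right
      exact ⟨_, hNC, by rw [ht, hn]; omega⟩
    · obtain ⟨t, ht, h, h3, h5⟩ := key (zpowers x ⊔ (A ⊔ B))
      have hxL := hx' (zpowers x ⊔ (A ⊔ B)) (mem_sup_left (mem_zpowers x))
      rw [← hAB] at h5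
      have hc := card_sup_of_coprime (zpowers x) (A ⊔ B) (by
        rw [Nat.card_zpowers, hx, hN]; norm_num)
      rw [Nat.card_zpowers, hx, hN] at hc
      refine ⟨zpowers x ⊔ (A ⊔ B), le_sup_right, ?_⟩
      have h3' := mt h3.mp hxL
      have h5' := mt h5.mp hxL
      rw [ht, hc]
      omega
    · obtain ⟨t, ht, h, h3, h5⟩ := key ⊤
      have hxL := hx' ⊤ (mem_top x)
      rw [← hAB] at h5
      refine ⟨_, le_top, ?_⟩
      have h3' := mt h3.mp hxL
      have h5' := mt h5.mp hxL
      rw [ht, card_top, h60]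
      omega
  refine le_antisymm (imCard_le_fourteen h60 A B hA hB ha hb hn) ?_
  have hs : ((({60, 90, 150, 450} : Finset ℕ) ×ˢ ({225, 450, 30, 60} : Finset ℕ)).image
      fun x => x.1 * x.2 / 225).card = 14 := by decide
  rw [← hs, imCard, ← Set.ncard_coe_finset]
  have : Finite (Subgroup G) := inferInstance
  refine Set.ncard_le_ncard ?_ (Set.finite_range _)
  intro m hm
  obtain ⟨⟨f, u⟩, hfu, rfl⟩ := Finset.mem_image.mp (Finset.mem_coe.mp hm)
  obtain ⟨hf, hu⟩ := Finset.mem_product.mp hfu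
  obtain ⟨D, hDn, hD, rfl⟩ := hF f hf
  obtain ⟨L, hL, rfl⟩ := hU u hu
  obtain ⟨H, rfl, rfl⟩ := exists_inf_eq_sup_eq (A ⊔ B) D L (by rw [hN, hi]; norm_num) hD hL
  refine ⟨H, ?_⟩
  dsimp only
  rw [← measure_mul_eq h60 A B hA hB, Nat.mul_div_cancel_left _ (by norm_num)]

end Dihedral

end NormalFifteen

/-! ### Recognizing the dihedral group -/

section DihedralRecognition

variable {G : Type*} [Group G]

/-- Conjugation by `x` swaps the commuting elements `c` and `xcx⁻¹`, so it fixes their product. A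
nontrivial product would generate `A`, making `x` centralize `A`. -/
theorem conj_eq_inv_of_card_prime {p : ℕ} [Fact p.Prime] (A : Subgroup G) [A.Normal]
    (hA : Nat.card A = p) (x : G) (hx : x ^ 2 = 1) (hxA : x ∉ centralizer (A : Set G)) (c : G)
    (hc : c ∈ A) : x * c * x⁻¹ = c⁻¹ := by
  have hb : x * c * x⁻¹ ∈ A := Normal.conj_mem inferInstance c hc x
  have hcomm := isMulCommutative_of_card_prime hA
  by_contra hne
  have hbc : (⟨x * c * x⁻¹ * c, mul_mem hb hc⟩ : A) ≠ 1 := by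
    intro h
    exact hne (eq_inv_of_mul_eq_one_left (congrArg Subtype.val h))
  refine hxA fun a ha => ?_
  obtain ⟨k, hk⟩ := mem_zpowers_iff.mp (mem_zpowers_of_prime_card hA hbc (g' := ⟨a, ha⟩))
  have hk : (x * c * x⁻¹ * c) ^ k = a := congrArg Subtype.val hk
  have hcb : c * (x * c * x⁻¹) = x * c * x⁻¹ * c :=
    congrArg Subtype.val (hcomm.is_comm.comm (⟨c, hc⟩ : A) ⟨_, hb⟩)
  have hxx : x * x = 1 := by rw [← sq, hx]
  have hxi : x⁻¹ = x := inv_eq_of_mul_eq_one_left hxx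
  have h : Commute x (x * c * x⁻¹ * c) := by
    rw [hxi] at hcb ⊢
    calc x * (x * c * x * c) = (x * x) * c * x * c := by group
      _ = c * x * c := by rw [hxx, one_mul]
      _ = c * x * c * (x * x) := by rw [hxx, mul_one]
      _ = c * (x * c * x) * x := by group
      _ = _ := by rw [hcb]
  rw [← hk]
  exact (h.zpow_right k).symm

theorem nonempty_mulEquiv_dihedralGroup {n : ℕ} [NeZero n] [Finite G] (hn : 2 < n)
    (hG : Nat.card G = 2 * n) (a x : G) (ha : orderOf a = n) (hx : x ^ 2 = 1)
    (hxa : x * a * x⁻¹ = a⁻¹) : Nonempty (G ≃* DihedralGroup n) := by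
  have hadd (i j : ZMod n) : a ^ (i + j).val = a ^ i.val * a ^ j.val := by
    rw [ZMod.val_add, ← pow_add]
    conv_rhs => rw [← pow_mod_orderOf, ha]
  have hsub (i j : ZMod n) : a ^ (j - i).val = (a ^ i.val)⁻¹ * a ^ j.val := by
    rw [eq_inv_mul_iff_mul_eq, ← hadd, add_sub_cancel]
  have hxx : x * x = 1 := by rw [← sq, hx]
  have hxp (k : ℕ) : a ^ k * x = x * (a ^ k)⁻¹ := by
    have h : x * a ^ k * x⁻¹ = (a ^ k)⁻¹ := by rw [← conj_pow, hxa, inv_pow]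
    rw [← h, ← mul_assoc, ← mul_assoc, hxx, one_mul, inv_eq_of_mul_eq_one_left hxx]
  let f : DihedralGroup n →* G := MonoidHom.mk' (fun g => match g with
    | .r i => a ^ i.val
    | .sr i => x * a ^ i.val) (by
      rintro (i | i) (j | j)
      · exact hadd i j
      · change x * a ^ (j - i).val = a ^ i.val * (x * a ^ j.val)
        rw [hsub, ← mul_assoc, ← mul_assoc, hxp]
      · change x * a ^ (i + j).val = x * a ^ i.val * a ^ j.val
        rw [hadd, mul_assoc]
      · change a ^ (j - i).val = x * a ^ i.val * (x * a ^ j.val)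
        rw [hsub, ← mul_assoc, mul_assoc x, hxp, ← mul_assoc, hxx, one_mul])
  have hf : Function.Injective f := by
    rw [injective_iff_map_eq_one]
    rintro (i | i) h
    · have h : a ^ i.val = 1 := h
      have h1 : n ∣ i.val := (dvd_of_eq ha.symm).trans (orderOf_dvd_of_pow_eq_one h)
      have h2 := Nat.eq_zero_of_dvd_of_lt h1 (ZMod.val_lt i)
      rw [(ZMod.val_eq_zero i).mp h2]
      rfl
    · exfalso
      have h : x * a ^ i.val = 1 := h
      have h1 : x = (a ^ i.val)⁻¹ := eq_inv_of_mul_eq_one_left h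
      -- If `x` were a power of `a`, then `a = a⁻¹`, against `n > 2`.
      have h2 : Commute x a := by
        rw [h1]
        exact ((Commute.refl a).pow_left _).inv_left
      rw [h2.eq, mul_inv_cancel_right] at hxa
      have h3 : a ^ 2 = 1 := by
        rw [sq]
        nth_rw 2 [hxa]
        exact mul_inv_cancel a
      have := Nat.le_of_dvd (by norm_num) (orderOf_dvd_of_pow_eq_one h3)
      omega
  have hb := (Nat.bijective_iff_injective_and_card f).mpr
    ⟨hf, by rw [DihedralGroup.nat_card, hG]⟩
  exact ⟨(MulEquiv.ofBijective f hb).symm⟩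

variable [Finite G] (h60 : Nat.card G = 60) (A B : Subgroup G) [A.Normal]
  [B.Normal] (hA : Nat.card A = 3) (hB : Nat.card B = 5)
  (ha : Nat.card (centralizer (A : Set G)) = 30)
  (hb : Nat.card (centralizer (B : Set G)) = 30)
  (hn : Nat.card (centralizer (A : Set G) ⊓ centralizer B : Subgroup G) = 30)
include h60 hA hB ha hb hn

/-- A Sylow 2-subgroup `P` has exponent 2. An `x ∈ P` outside `C` inverts `A` and `B` and commutes
with an involution `z ∈ P ∩ C`, so it inverts `cdz`, of order 30. -/
theorem nonempty_mulEquiv_dihedralGroup_thirty (h4 : ∀ y : G, orderOf y ≠ 4) :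
    Nonempty (G ≃* DihedralGroup 30) := by
  obtain ⟨P⟩ : Nonempty (Sylow 2 G) := inferInstance
  have hP := card_sylow_two h60 P
  have hPc : IsMulCommutative (P : Subgroup G) := isMulCommutative_of_card_four hP
  have hsq (y : G) (hy : y ∈ (P : Subgroup G)) : y ^ 2 = 1 := by
    have hd : orderOf y ∣ 4 := hP ▸ orderOf_dvd_natCard _ hy
    apply orderOf_dvd_iff_pow_eq_one.mp
    obtain h | h | h := dvd_four hd
    · rw [h]; norm_num
    · rw [h]
    · exact absurd h (h4 y)
  set C := centralizer (A : Set G) ⊓ centralizer (B : Set G) with hC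
  have hAC := eq_of_le_of_card_eq (inf_le_left : C ≤ _) (hn.trans ha.symm)
  have hBC := eq_of_le_of_card_eq (inf_le_right : C ≤ _) (hn.trans hb.symm)
  obtain ⟨x, hxP, hxC⟩ : ∃ x ∈ (P : Subgroup G), x ∉ C := by
    by_contra! h
    have := dvd_card_of_le hP (show (P : Subgroup G) ≤ C from h)
    omega
  obtain ⟨z, hzPC, hz⟩ : ∃ z ∈ (P : Subgroup G) ⊓ C, orderOf z = 2 := by
    -- `|PC| |P ∩ C| = 120` with `|PC| ≤ 60` forces `P ∩ C` to be nontrivial.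
    have hs := card_sup_mul_card_inf (P : Subgroup G) C
    rw [hP, hn] at hs
    apply exists_mem_orderOf
    have hd := card_dvd_of_le (inf_le_left : (P : Subgroup G) ⊓ C ≤ P)
    rw [hP] at hd
    obtain h | h | h := dvd_four hd
    · have := Nat.le_of_dvd (by norm_num) (card_subgroup_dvd_sixty h60 ((P : Subgroup G) ⊔ C))
      rw [h] at hs
      omega
    · omega
    · omega
  obtain ⟨c, hcA, hc⟩ := exists_mem_orderOf (p := 3) A (by rw [hA])
  obtain ⟨d, hdB, hd⟩ := exists_mem_orderOf (p := 5) B (by rw [hB])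
  have hxc := conj_eq_inv_of_card_prime A hA x (hsq x hxP) (hAC ▸ hxC) c hcA
  have hxd := conj_eq_inv_of_card_prime B hB x (hsq x hxP) (hBC ▸ hxC) d hdB
  have hxz : x * z * x⁻¹ = z⁻¹ := by
    have h : x * z = z * x :=
      congrArg Subtype.val (hPc.is_comm.comm (⟨x, hxP⟩ : (P : Subgroup G)) ⟨z, hzPC.1⟩)
    have h2 : z * z = 1 := by rw [← sq, ← hz, pow_orderOf_eq_one]
    rw [h, mul_inv_cancel_right, inv_eq_of_mul_eq_one_left h2]
  have hcd : Commute c d := ((le_centralizer_of_card_three_five A B hA hB) hcA d hdB).symm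
  have hzc : Commute c z := hzPC.2.1 c hcA
  have hzd : Commute d z := hzPC.2.2 d hdB
  have hcd15 : orderOf (c * d) = 15 := by
    rw [hcd.orderOf_mul_eq_mul_orderOf_of_coprime (by rw [hc, hd]; norm_num), hc, hd]
  have hcdz := hzc.mul_left hzd
  refine nonempty_mulEquiv_dihedralGroup (by norm_num) h60 (c * d * z) x ?_ (hsq x hxP) ?_
  · rw [hcdz.orderOf_mul_eq_mul_orderOf_of_coprime (by rw [hcd15, hz]; norm_num), hcd15, hz]
  · rw [← conj_mul, ← conj_mul, hxc, hxd, hxz, hcdz.eq, hcd.eq]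
    group

end DihedralRecognition

theorem imCard_dihedralGroup_thirty : imCard (DihedralGroup 30) = 14 := by
  have hcard : Nat.card (DihedralGroup 30) = 60 := DihedralGroup.nat_card
  have hnorm (i : ZMod 30) : (zpowers (DihedralGroup.r i)).Normal := by
    refine ⟨fun g hg x => ?_⟩
    obtain ⟨k, rfl⟩ := mem_zpowers_iff.mp hg
    obtain j | j := x
    · refine mem_zpowers_iff.mpr ⟨k, ?_⟩
      simp [DihedralGroup.r_zpow]
    · refine mem_zpowers_iff.mpr ⟨-k, ?_⟩
      simp [DihedralGroup.r_zpow]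
  have hA : Nat.card (zpowers (DihedralGroup.r (10 : ZMod 30))) = 3 := by
    rw [Nat.card_zpowers, DihedralGroup.orderOf_r]; decide
  have hB : Nat.card (zpowers (DihedralGroup.r (6 : ZMod 30))) = 5 := by
    rw [Nat.card_zpowers, DihedralGroup.orderOf_r]; decide
  have hr (i : ZMod 30) : zpowers (DihedralGroup.r (1 : ZMod 30)) ≤
      centralizer (zpowers (DihedralGroup.r i) : Set (DihedralGroup 30)) := by
    rw [zpowers_le]
    intro g hg
    obtain ⟨k, rfl⟩ := mem_zpowers_iff.mp hg
    simp [DihedralGroup.r_zpow, add_comm]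
  have hr1 : Nat.card (zpowers (DihedralGroup.r (1 : ZMod 30))) = 30 := by
    rw [Nat.card_zpowers, DihedralGroup.orderOf_r_one]
  have hs (i : ZMod 30) (hi : i ≠ -i) : DihedralGroup.sr 0 ∉
      centralizer (zpowers (DihedralGroup.r i) : Set (DihedralGroup 30)) := by
    intro h
    have := h (DihedralGroup.r i) (mem_zpowers _)
    simp at this
    exact hi (by simpa using this.symm)
  -- The centralizer contains all rotations but not the reflection `sr 0`.
  have hc (i : ZMod 30) (hi : i ≠ -i) :
      Nat.card (centralizer (zpowers (DihedralGroup.r i) : Set (DihedralGroup 30))) = 30 := by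
    have h1 := dvd_card_of_le hr1 (hr i)
    have h2 := Nat.le_of_dvd (by norm_num) (card_subgroup_dvd_sixty hcard
      (centralizer (zpowers (DihedralGroup.r i) : Set (DihedralGroup 30))))
    have h3 : Nat.card (centralizer (zpowers (DihedralGroup.r i) : Set (DihedralGroup 30))) ≠
        60 := by
      intro h
      apply hs i hi
      rw [eq_top_of_card_eq _ (h.trans hcard.symm)]
      exact mem_top _
    have : 0 < Nat.card (centralizer (zpowers (DihedralGroup.r i) : Set (DihedralGroup 30))) :=
      Nat.card_pos
    omega
  have hA' := hc 10 (by decide)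
  have hB' := hc 6 (by decide)
  have := hnorm (10 : ZMod 30)
  have := hnorm (6 : ZMod 30)
  refine imCard_eq_fourteen hcard (zpowers (DihedralGroup.r (10 : ZMod 30)))
    (zpowers (DihedralGroup.r (6 : ZMod 30))) hA hB hA' hB' ?_
    (.sr 0) (DihedralGroup.orderOf_sr 0) (hs 10 (by decide))
  refine Nat.dvd_antisymm ?_ (dvd_card_of_le hr1 (le_inf (hr 10) (hr 6)))
  exact (card_dvd_of_le inf_le_left).trans (dvd_of_eq hA')

/-! ### Case distinction over all groups of order 60 -/

section Classification

variable {G : Type*} [Group G] [Finite G] (h60 : Nat.card G = 60)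
include h60

theorem card_centralizer_of_card_three (A : Subgroup G) [A.Normal] (hA : Nat.card A = 3) :
    Nat.card (centralizer (A : Set G)) = 30 ∨ Nat.card (centralizer (A : Set G)) = 60 := by
  have := isCyclic_of_prime_card hA
  have h := index_centralizer_dvd_totient A
  rw [hA, show Nat.totient 3 = 2 by decide] at h
  have hm := card_mul_index (centralizer (A : Set G))
  rw [h60] at hm
  obtain h | h := (Nat.dvd_prime Nat.prime_two).mp h <;> rw [h] at hm <;> omega

/-- Index 4 would make `G` surject onto the cyclic group `Aut B` of order 4; a power of a preimage
of a generator would have order 4. -/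
theorem card_centralizer_of_card_five (B : Subgroup G) [B.Normal] (hB : Nat.card B = 5)
    (h4 : ∀ y : G, orderOf y ≠ 4) :
    Nat.card (centralizer (B : Set G)) = 30 ∨ Nat.card (centralizer (B : Set G)) = 60 := by
  have hBc := isCyclic_of_prime_card hB
  have h := index_centralizer_dvd_totient B
  rw [hB, show Nat.totient 5 = 4 by decide] at h
  have hm := card_mul_index (centralizer (B : Set G))
  rw [h60] at hm
  obtain h | h | h := dvd_four h
  · rw [h] at hm
    omega
  · rw [h] at hm
    omega
  · exfalso
    have hcard : Nat.card (MulAut B) = 4 := by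
      rw [IsCyclic.card_mulAut, hB]
      decide
    have hcyc : IsCyclic (MulAut B) := by
      have e := IsCyclic.mulAutMulEquiv B
      rw [hB] at e
      exact isCyclic_of_surjective e.symm e.symm.surjective
    rw [← ker_conjNormal, index_ker] at h
    have hr := eq_top_of_card_eq _ (h.trans hcard.symm)
    obtain ⟨φ, hφ⟩ := IsCyclic.exists_ofOrder_eq_natCard (α := MulAut B)
    obtain ⟨y, rfl⟩ := MonoidHom.range_eq_top.mp hr φ
    have hy : 4 ∣ orderOf y := (dvd_of_eq (hφ.trans hcard).symm).trans (orderOf_map_dvd _ y)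
    obtain ⟨k, hk⟩ := hy
    have h0 := orderOf_pos y
    refine h4 (y ^ k) ?_
    rw [orderOf_pow_of_dvd (by omega) (by rw [hk]; exact dvd_mul_left _ _), hk]
    exact Nat.mul_div_cancel _ (by omega)

theorem imCard_le_thirteen_or_dihedral : imCard G ≤ 13 ∨ Nonempty (G ≃* DihedralGroup 30) := by
  obtain h5 | h5 := card_sylow_five_eq h60
  swap
  · left
    rw [imCard_of_card_sylow_five_eq_six h60 h5]
    norm_num
  obtain ⟨Q⟩ : Nonempty (Sylow 5 G) := inferInstance
  obtain ⟨R⟩ : Nonempty (Sylow 3 G) := inferInstance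
  have : Subsingleton (Sylow 5 G) := (Nat.card_eq_one_iff_unique.mp h5).1
  have hB := card_sylow_five h60 Q
  have hA := card_sylow_three h60 R
  have := Q.normal_of_subsingleton
  by_cases h3 : Nat.card (Sylow 3 G) = 1
  swap
  · exact Or.inl ((imCard_le_ten_of_card_sylow_three h60 Q h3).trans (by norm_num))
  have : Subsingleton (Sylow 3 G) := (Nat.card_eq_one_iff_unique.mp h3).1
  have := R.normal_of_subsingleton
  generalize (Q : Subgroup G) = B at *
  generalize (R : Subgroup G) = A at *
  by_cases h4 : ∃ y : G, orderOf y = 4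
  · obtain ⟨y, hy⟩ := h4
    exact Or.inl ((imCard_le_twelve_of_orderOf_eq_four h60 A B hA hB y hy).trans (by norm_num))
  push Not at h4
  have ha := card_centralizer_of_card_three h60 A hA
  have hb := card_centralizer_of_card_five h60 B hB h4
  have hT (K : Subgroup G) (h : Nat.card K = 60) : K = ⊤ :=
    eq_top_of_card_eq _ (h.trans h60.symm)
  have hn : 15 ∣ Nat.card (centralizer (A : Set G) ⊓ centralizer (B : Set G) : Subgroup G) :=
    dvd_card_of_le (card_sup_fifteen A B hA hB)
      (le_inf (sup_le_centralizer_left A B hA hB) (sup_le_centralizer_right A B hA hB))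
  have hna := card_dvd_of_le (inf_le_left : centralizer (A : Set G) ⊓ centralizer (B : Set G) ≤ _)
  by_cases hD : Nat.card (centralizer (A : Set G)) = 30 ∧
      Nat.card (centralizer (B : Set G)) = 30 ∧
      Nat.card (centralizer (A : Set G) ⊓ centralizer (B : Set G) : Subgroup G) = 30
  · exact Or.inr (nonempty_mulEquiv_dihedralGroup_thirty h60 A B hA hB hD.1 hD.2.1 hD.2.2 h4)
  refine Or.inl (imCard_le_thirteen h60 A B hA hB rfl rfl rfl ?_)
  -- If both centralizers have order 30, their intersection has order 15 or 30, and 30 is the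
  -- dihedral case. If one is everything, the intersection is the other.
  obtain ha | ha := ha
  · obtain hb | hb := hb
    · rw [ha] at hna
      have := Nat.le_of_dvd (by norm_num) hna
      have : 0 < Nat.card (centralizer (A : Set G) ⊓ centralizer (B : Set G) : Subgroup G) :=
        Nat.card_pos
      omega
    · rw [hT _ hb, inf_top_eq, card_top, ha, h60]
      omega
  · rw [hT _ ha, top_inf_eq, card_top, h60]
    omega

theorem imCard_eq_fourteen_iff : imCard G = 14 ↔ Nonempty (G ≃* DihedralGroup 30) := by
  constructor
  · intro h
    refine (imCard_le_thirteen_or_dihedral h60).resolve_left ?_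
    omega
  · rintro ⟨e⟩
    rw [imCard_congr e, imCard_dihedralGroup_thirty]

theorem imCard_le_fourteen_of_card_sixty : imCard G ≤ 14 := by
  obtain h | ⟨⟨e⟩⟩ := imCard_le_thirteen_or_dihedral h60
  · omega
  · rw [imCard_congr e, imCard_dihedralGroup_thirty]

end Classification

/-! ### The maxima -/

theorem finite_of_card_sixty {G : Type*} (h60 : Nat.card G = 60) : Finite G :=
  Nat.finite_of_card_ne_zero (by omega)

theorem isGreatest_imCardValues : IsGreatest (imCardValues.{u} 60) 14 := by
  constructor
  · refine ⟨ULift.{u} (DihedralGroup 30), inferInstance, ?_, ?_⟩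
    · rw [Nat.card_ulift, DihedralGroup.nat_card]
    · rw [imCard_congr MulEquiv.ulift, imCard_dihedralGroup_thirty]
  · rintro _ ⟨G, _, h60, rfl⟩
    have := finite_of_card_sixty h60
    exact imCard_le_fourteen_of_card_sixty h60

theorem isGreatest_imCardValuesNilpotent : IsGreatest (imCardValuesNilpotent.{u} 60) 12 := by
  constructor
  · have hc : Nat.card (Multiplicative (ZMod 60)) = 60 := Nat.card_zmod 60
    refine ⟨ULift.{u} (Multiplicative (ZMod 60)), inferInstance, ?_, inferInstance, ?_⟩
    · rw [Nat.card_ulift, hc]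
    · rw [imCard_congr MulEquiv.ulift, imCard_of_isCyclic hc]
  · rintro _ ⟨G, _, h60, _, rfl⟩
    have := finite_of_card_sixty h60
    have := isMulCommutative_of_isNilpotent h60
    exact imCard_le_of_isMulCommutative h60

end ChermakDelgado

theorem mainTheorem5 :
    ((IsGreatest (ChermakDelgado.imCardValuesNilpotent.{u} 60)
          (ChermakDelgado.imMaxNilpotent.{u} 60) ∧
        ChermakDelgado.imMaxNilpotent.{u} 60 = 12) ∧
      (IsGreatest (ChermakDelgado.imCardValues.{u} 60) (ChermakDelgado.imMax.{u} 60) ∧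
        ChermakDelgado.imMax.{u} 60 = 14)) ∧
    ((¬ Group.IsSolvable (alternatingGroup (Fin 5)) ∧
        ChermakDelgado.imCard (alternatingGroup (Fin 5)) = 8) ∧
      ∀ (G : Type u) [Group G], Nat.card G = 60 → ¬ Group.IsSolvable G →
        Nonempty (G ≃* alternatingGroup (Fin 5)) ∧ ChermakDelgado.imCard G = 8) ∧
    (∀ (G : Type u) [Group G], Nat.card G = 60 →
      (ChermakDelgado.imCard G = ChermakDelgado.imMax.{u} 60 ↔
        Nonempty (G ≃* DihedralGroup 30))) := by
  -- On `ℕ`, `sSup` is 0 for unbounded sets, so the maxima are read off from `IsGreatest`.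
  have h12 : ChermakDelgado.imMaxNilpotent.{u} 60 = 12 :=
    ChermakDelgado.isGreatest_imCardValuesNilpotent.csSup_eq
  have h14 : ChermakDelgado.imMax.{u} 60 = 14 :=
    ChermakDelgado.isGreatest_imCardValues.csSup_eq
  rw [h12, h14]
  refine ⟨⟨⟨ChermakDelgado.isGreatest_imCardValuesNilpotent, rfl⟩,
    ChermakDelgado.isGreatest_imCardValues, rfl⟩,
    ⟨⟨ChermakDelgado.not_isSolvable_alternatingGroup_five,
      ChermakDelgado.imCard_alternatingGroup_five⟩, fun G _ h60 hG => ?_⟩, fun G _ h60 => ?_⟩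
  · have := ChermakDelgado.finite_of_card_sixty h60
    have h6 := ChermakDelgado.card_sylow_five_of_not_isSolvable h60 hG
    exact ⟨ChermakDelgado.nonempty_mulEquiv_alternatingGroup h60 h6,
      ChermakDelgado.imCard_of_card_sylow_five_eq_six h60 h6⟩
  · have := ChermakDelgado.finite_of_card_sixty h60
    exact ChermakDelgado.imCard_eq_fourteen_iff h60
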